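/- **Theorem (isoperimetric weak Pontryagin maximum principle with time delay).** Let $t_1<t_2$, $0<\tau<t_2-t_1$, and let $L:[t_1,t_2]\times\mathbb R^n\times\mathbb R^m\times\mathbb R^n\times\mathbb R^m\to\mathbb R$, and $g$, $\varphi$ on the same domain with values in $\mathbb R^k$ and $\mathbb R^n$, be $C^1$ functions. Write $[q,u]_\tau(t)=(t,q(t),u(t),q(t-\tau),u(t-\tau))$. Consider the problem of minimizing $$\int_{t_1}^{t_2}L[q,u]_\tau(t)\,dt$$ over all $q\in C^1([t_1-\tau,t_2];\mathbb R^n)$, $u\in C^0([t_1-\tau,t_2];\mathbb R^m)$ subject to $$\dot q(t)=\varphi[q,u]_\tau(t)\ \ (t\in[t_1,t_2]),\qquad \int_{t_1}^{t_2}g[q,u]_\tau(t)\,dt=l,\qquad q(t)=\delta(t)\ \ (t\in[t_1-\tau,t_1]),$$ where $l\in\mathbb R^k$ and $\delta$ are given. For $\lambda\in\mathbb R^k$ and $p:[t_1,t_2]\to\mathbb R^n$ put $$H(t,q,u,q_\tau,u_\tau,p,\lambda)=L-\lambda\cdot g+p\cdot\varphi,\qquad H[t]=H(t,q(t),u(t),q(t-\tau),u(t-\tau),p(t),\lambda),$$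 and let $\partial_iH[t]$ be the partial gradient in the $i$-th argument at that point. Consider the conditions 1. $p$ is continuous on $[t_1,t_2]$ and $C^1$ on each of $[t_1,t_2-\tau]$ and $[t_2-\tau,t_2]$; 2. $\dot q(t)=\partial_6H[t]$ and $\dot p(t)=-\partial_2H[t]-\partial_4H[t+\tau]$ for $t_1\le t\le t_2-\tau$; 3. $\dot q(t)=\partial_6H[t]$ and $\dot p(t)=-\partial_2H[t]$ for $t_2-\tau\le t\le t_2$; 4. $\partial_3H[t]+\partial_5H[t+\tau]=0$ for $t_1\le t\le t_2-\tau$, and $\partial_3H[t]=0$ for $t_2-\tau\le t\le t_2$, where the derivatives of $p$ are one-sided at the end points of the respective interval. Call an admissible pair $(q,u)$ *abnormal* if there are $\lambda\neq0$ and $p$ with $p(t_2)=0$ satisfying (1)–(4) with $L$ replaced by $0$, and *normal* otherwise. If $(q,u)$ is a minimizer (it suffices: a local minimizer with respect to uniform convergence of $(q,u)$) of the problem and is normal, then there are $\lambda\in\mathbb R^k$ and a covector function $p:[t_1,t_2]\to\mathbb R^n$ satisfying (1)–(4). Moreover, $p\in C^1([t_1,t_2])$ whenever $\partial_4H[t_2]=0$,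 that is, whenever the two equations for $\dot p$ agree at $t=t_2-\tau$. -/

import Mathlib

open Set

noncomputable section

namespace DelayControl

/-- The Euclidean space `ℝⁿ`. -/
abbrev E (n : ℕ) : Type := EuclideanSpace ℝ (Fin n)

/-- The points `(t, q, u, q_τ, u_τ)` at which Lagrangian, constraint and velocity are evaluated
(arguments number 1 to 5). -/
abbrev Pt (n m : ℕ) : Type := ℝ × E n × E m × E n × E m

/-- Data of an isoperimetric optimal control problem with time delay: state in `ℝⁿ`, control
in `ℝᵐ`, and `k` isoperimetric constraints. -/
structure Problem (n m k : ℕ) where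
  t₁ : ℝ
  t₂ : ℝ
  /-- the delay -/
  τ : ℝ
  /-- the Lagrangian -/
  L : Pt n m → ℝ
  /-- the integrand of the isoperimetric constraints -/
  g : Pt n m → E k
  /-- the velocity vector -/
  φ : Pt n m → E n
  /-- the prescribed value of the isoperimetric integrals -/
  l : E k
  /-- the prescribed initial function -/
  δ : ℝ → E n

/-- `[q,u]_τ(t) = (t, q(t), u(t), q(t-τ), u(t-τ))`. -/
def delayPt {n m : ℕ} (τ : ℝ) (q : ℝ → E n) (u : ℝ → E m) (t : ℝ) : Pt n m :=
  (t, q t, u t, q (t - τ), u (t - τ))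

section Partials

variable {n m k : ℕ}

/-! Partial gradients of a function `H` of `(t, q, u, q_τ, u_τ)`, `p` and `λ` with respect to
its second to sixth argument. -/

def d₂ (H : Pt n m → E n → E k → ℝ) (z : Pt n m) (p : E n) (lam : E k) : E n :=
  gradient (fun x : E n => H (z.1, x, z.2.2.1, z.2.2.2.1, z.2.2.2.2) p lam) z.2.1

def d₃ (H : Pt n m → E n → E k → ℝ) (z : Pt n m) (p : E n) (lam : E k) : E m :=
  gradient (fun v : E m => H (z.1, z.2.1, v, z.2.2.2.1, z.2.2.2.2) p lam) z.2.2.1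

def d₄ (H : Pt n m → E n → E k → ℝ) (z : Pt n m) (p : E n) (lam : E k) : E n :=
  gradient (fun y : E n => H (z.1, z.2.1, z.2.2.1, y, z.2.2.2.2) p lam) z.2.2.2.1

def d₅ (H : Pt n m → E n → E k → ℝ) (z : Pt n m) (p : E n) (lam : E k) : E m :=
  gradient (fun w : E m => H (z.1, z.2.1, z.2.2.1, z.2.2.2.1, w) p lam) z.2.2.2.2

def d₆ (H : Pt n m → E n → E k → ℝ) (z : Pt n m) (p : E n) (lam : E k) : E n :=
  gradient (fun r : E n => H z r lam) p

end Partials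

namespace Problem

variable {n m k : ℕ}

/-- The cost `∫ L[q,u]_τ(t) dt` over `[t₁, t₂]`. -/
def cost (P : Problem n m k) (q : ℝ → E n) (u : ℝ → E m) : ℝ :=
  ∫ t in P.t₁..P.t₂, P.L (delayPt P.τ q u t)

/-- `(q, u)` is an admissible pair: `q` is `C¹` and `u` is `C⁰` on `[t₁ - τ, t₂]`, the delayed
control system holds on `[t₁, t₂]`, and the isoperimetric constraints and the initial condition
are satisfied. The terminal state and the initial piece of the control are free. -/
structure IsAdmissible (P : Problem n m k) (q : ℝ → E n) (u : ℝ → E m) : Prop where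
  state_C1 : ContDiffOn ℝ 1 q (Icc (P.t₁ - P.τ) P.t₂)
  control_C0 : ContinuousOn u (Icc (P.t₁ - P.τ) P.t₂)
  dynamics : ∀ t ∈ Icc P.t₁ P.t₂,
    HasDerivWithinAt q (P.φ (delayPt P.τ q u t)) (Icc (P.t₁ - P.τ) P.t₂) t
  isoperimetric : ∫ t in P.t₁..P.t₂, P.g (delayPt P.τ q u t) = P.l
  initial : ∀ t ∈ Icc (P.t₁ - P.τ) P.t₁, q t = P.δ t

/-- `(q, u)` is a (weak) local minimizer: an admissible pair whose cost is minimal among all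
admissible pairs that are uniformly close to it. Global minimizers are local minimizers. -/
def IsLocalMinimizer (P : Problem n m k) (q : ℝ → E n) (u : ℝ → E m) : Prop :=
  P.IsAdmissible q u ∧ ∃ ε > 0, ∀ (q' : ℝ → E n) (u' : ℝ → E m), P.IsAdmissible q' u' →
    (∀ t ∈ Icc (P.t₁ - P.τ) P.t₂, ‖q' t - q t‖ < ε ∧ ‖u' t - u t‖ < ε) →
    P.cost q u ≤ P.cost q' u'

/-- The isoperimetric Hamiltonian `H = L - λ · g + p · φ`. -/
def hamiltonian (P : Problem n m k) (z : Pt n m) (p : E n) (lam : E k) : ℝ :=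
  P.L z - inner ℝ lam (P.g z) + inner ℝ p (P.φ z)

/-- The isoperimetric Hamiltonian system and the stationarity conditions with time delay, for
the covector function `p` and the multiplier `lam`. On each of the intervals `[t₁, t₂ - τ]` and
`[t₂ - τ, t₂]` derivatives of `p` are taken relative to that interval, hence one-sided at its
end points. -/
structure IsPontryaginExtremal (P : Problem n m k) (q : ℝ → E n) (u : ℝ → E m)
    (p : ℝ → E n) (lam : E k) : Prop where
  covector_C1_left : ContDiffOn ℝ 1 p (Icc P.t₁ (P.t₂ - P.τ))
  covector_C1_right : ContDiffOn ℝ 1 p (Icc (P.t₂ - P.τ) P.t₂)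
  state : ∀ t ∈ Icc P.t₁ P.t₂,
    HasDerivWithinAt q (d₆ P.hamiltonian (delayPt P.τ q u t) (p t) lam)
      (Icc (P.t₁ - P.τ) P.t₂) t
  costate_left : ∀ t ∈ Icc P.t₁ (P.t₂ - P.τ),
    HasDerivWithinAt p
      (-d₂ P.hamiltonian (delayPt P.τ q u t) (p t) lam
        - d₄ P.hamiltonian (delayPt P.τ q u (t + P.τ)) (p (t + P.τ)) lam)
      (Icc P.t₁ (P.t₂ - P.τ)) t
  costate_right : ∀ t ∈ Icc (P.t₂ - P.τ) P.t₂,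
    HasDerivWithinAt p (-d₂ P.hamiltonian (delayPt P.τ q u t) (p t) lam)
      (Icc (P.t₂ - P.τ) P.t₂) t
  stationary_left : ∀ t ∈ Icc P.t₁ (P.t₂ - P.τ),
    d₃ P.hamiltonian (delayPt P.τ q u t) (p t) lam
      + d₅ P.hamiltonian (delayPt P.τ q u (t + P.τ)) (p (t + P.τ)) lam = 0
  stationary_right : ∀ t ∈ Icc (P.t₂ - P.τ) P.t₂,
    d₃ P.hamiltonian (delayPt P.τ q u t) (p t) lam = 0

/-- `(q, u)` is abnormal: it is an extremal of some nontrivial linear combination of the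
isoperimetric integrals alone, i.e. for the problem with the Lagrangian `L` replaced by `0` there
is a multiplier `lam ≠ 0` and a covector function, vanishing at the free end point `t₂`, which
satisfy the delayed Hamiltonian system and the stationarity conditions. -/
def IsAbnormal (P : Problem n m k) (q : ℝ → E n) (u : ℝ → E m) : Prop :=
  ∃ (lam : E k) (p : ℝ → E n), lam ≠ 0 ∧ p P.t₂ = 0 ∧
    IsPontryaginExtremal { P with L := fun _ => 0 } q u p lam

/-- `(q, u)` is normal if it is not abnormal; this is automatic when there is no constraint. -/
def IsNormal (P : Problem n m k) (q : ℝ → E n) (u : ℝ → E m) : Prop :=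
  ¬ P.IsAbnormal q u

end Problem

end DelayControl

/-!
The variations of an admissible pair `(q, u)` are paths over `[t₁, t₂]`, and the problem becomes a
smooth optimization problem in the Banach space of such paths: the integrated state equation
`x = ∫ (φ[q + x, u + v]_τ - φ[q, u]_τ)` and the isoperimetric integrals are the constraints. The
linearized state equation is a Volterra equation with delay, hence solvable for every right-hand
side, because its integral operator contracts an exponentially weighted norm. The Lagrange
multiplier rule therefore needs multipliers `c` and `λ` only for the cost and the isoperimetric
integrals. The multiplier of the state equation is found directly: the backward equation for `p`,
in which the delay turns into an advance, is a Volterra equation as well, and integration by parts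
together with the shift `t ↦ t + τ` removes the state variation from `c δL - λ · δg`. What remains
is the integral of the stationarity expression against an arbitrary control variation, so that the
fundamental lemma of the calculus of variations applies. In the abnormal case `c = 0`, otherwise
`c = 1`.
-/

namespace DelayControl

open Filter Topology MeasureTheory

section LagrangeMultipliers

variable {𝒳 B H : Type*} [NormedAddCommGroup 𝒳] [NormedSpace ℝ 𝒳] [CompleteSpace 𝒳]
  [NormedAddCommGroup B] [NormedSpace ℝ B] [CompleteSpace B]
  [NormedAddCommGroup H] [InnerProductSpace ℝ H] [FiniteDimensional ℝ H]
  {J : 𝒳 → ℝ} {F : 𝒳 → B} {G : 𝒳 → H}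
  {J' : 𝒳 →L[ℝ] ℝ} {F' : 𝒳 →L[ℝ] B} {G' : 𝒳 →L[ℝ] H} {x₀ : 𝒳}

theorem exists_multipliers_of_surjective
    (hextr : IsLocalExtrOn J {x | F x = F x₀ ∧ G x = G x₀} x₀)
    (hJ : HasStrictFDerivAt J J' x₀) (hF : HasStrictFDerivAt F F' x₀)
    (hG : HasStrictFDerivAt G G' x₀) (hsurj : Function.Surjective F') :
    ∃ (c : ℝ) (mu : H), (c ≠ 0 ∨ mu ≠ 0) ∧
      ∀ x, F' x = 0 → c * J' x = inner ℝ mu (G' x) := by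
  have hextr' : IsLocalExtrOn J {x | (F x, G x) = (F x₀, G x₀)} x₀ := by
    simpa only [Prod.mk.injEq] using hextr
  obtain ⟨Λ, c, hne, hΛ⟩ := hextr'.exists_linear_map_of_hasStrictFDerivAt (hF.prodMk hG) hJ
  have hΛ_split : ∀ b y, Λ (b, y) = Λ (b, 0) + Λ (0, y) := fun b y => by
    rw [← map_add, Prod.mk_add_mk, add_zero, zero_add]
  let Λ_H : StrongDual ℝ H := (Λ ∘ₗ LinearMap.inr ℝ B H).toContinuousLinearMap
  let mu : H := -(InnerProductSpace.toDual ℝ H).symm Λ_H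
  have hmu : ∀ y, inner ℝ mu y = -Λ (0, y) := fun y => by
    rw [inner_neg_left, InnerProductSpace.toDual_symm_apply]
    rfl
  refine ⟨c, mu, ?_, fun x hx => ?_⟩
  · by_contra! h0
    refine hne (Prod.ext (LinearMap.ext fun ⟨b, y⟩ => ?_) h0.1)
    have hzero : ∀ y, Λ (0, y) = 0 := fun y => by simpa [h0.2] using hmu y
    obtain ⟨x, rfl⟩ := hsurj b
    have h := hΛ x
    rw [ContinuousLinearMap.prod_apply, hΛ_split, hzero, h0.1, add_zero, zero_smul, add_zero] at h
    simp [hΛ_split (F' x) y, h, hzero]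
  · have h := hΛ x
    rw [ContinuousLinearMap.prod_apply, hx, smul_eq_mul] at h
    rw [hmu]
    linarith

theorem exists_normalized_multipliers_of_surjective
    (hextr : IsLocalExtrOn J {x | F x = F x₀ ∧ G x = G x₀} x₀)
    (hJ : HasStrictFDerivAt J J' x₀) (hF : HasStrictFDerivAt F F' x₀)
    (hG : HasStrictFDerivAt G G' x₀) (hsurj : Function.Surjective F') :
    ∃ (c : ℝ) (mu : H), (c = 1 ∨ c = 0 ∧ mu ≠ 0) ∧
      ∀ x, F' x = 0 → c * J' x = inner ℝ mu (G' x) := by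
  obtain ⟨c, mu, hne, hmul⟩ := exists_multipliers_of_surjective hextr hJ hF hG hsurj
  rcases eq_or_ne c 0 with rfl | hc
  · exact ⟨0, mu, .inr ⟨rfl, hne.resolve_left fun h => h rfl⟩, hmul⟩
  · refine ⟨1, c⁻¹ • mu, .inl rfl, fun x hx => ?_⟩
    rw [real_inner_smul_left, ← hmul x hx, inv_mul_cancel_left₀ hc, one_mul]

end LagrangeMultipliers

section WeightedNorm

variable {K W : Type*} [TopologicalSpace K] [NormedAddCommGroup W] [NormedSpace ℝ W]
  {T : C(K, W) →L[ℝ] C(K, W)} {σ : C(K, ℝ)} {c : ℝ}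

theorem norm_pow_apply_le_of_weighted
    (hT : ∀ (w : C(K, W)) (M : ℝ), (∀ s, ‖w s‖ ≤ M * σ s) → ∀ t, ‖T w t‖ ≤ c * M * σ t)
    {w : C(K, W)} {M : ℝ} (hw : ∀ s, ‖w s‖ ≤ M * σ s) (N : ℕ) (t : K) :
    ‖(T ^ N) w t‖ ≤ c ^ N * M * σ t := by
  induction N generalizing t with
  | zero => simpa using hw t
  | succ N ih =>
    rw [pow_succ', pow_succ', mul_assoc c]
    exact hT _ _ ih t

/-- An operator that contracts the equivalent norm `sup ‖w t‖ / σ t` has a small power. -/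
theorem isUnit_one_sub_of_weighted [CompactSpace K] [CompleteSpace W] (hσ : ∀ t, 1 ≤ σ t)
    (hc₀ : 0 ≤ c) (hc₁ : c < 1)
    (hT : ∀ (w : C(K, W)) (M : ℝ), (∀ s, ‖w s‖ ≤ M * σ s) → ∀ t, ‖T w t‖ ≤ c * M * σ t) :
    IsUnit (1 - T) := by
  have hpow : ∀ N, ‖T ^ N‖ ≤ c ^ N * ‖σ‖ := fun N => by
    refine ContinuousLinearMap.opNorm_le_bound _ (by positivity) fun w => ?_
    refine (ContinuousMap.norm_le _ (by positivity)).2 fun t => ?_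
    have hw : ∀ s, ‖w s‖ ≤ ‖w‖ * σ s := fun s =>
      (w.norm_coe_le_norm s).trans (le_mul_of_one_le_right (norm_nonneg w) (hσ s))
    calc ‖(T ^ N) w t‖ ≤ c ^ N * ‖w‖ * σ t := norm_pow_apply_le_of_weighted hT hw N t
      _ ≤ c ^ N * ‖w‖ * ‖σ‖ := by gcongr; exact (le_abs_self _).trans (σ.norm_coe_le_norm t)
      _ = c ^ N * ‖σ‖ * ‖w‖ := by ring
  have hlim : Tendsto (fun N => c ^ N * ‖σ‖) atTop (𝓝 0) := by
    simpa using (tendsto_pow_atTop_nhds_zero_of_lt_one hc₀ hc₁).mul_const ‖σ‖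
  obtain ⟨N, hN⟩ := (hlim.eventually_lt_const one_pos).exists
  have hunit : IsUnit (1 - T ^ N) := isUnit_one_sub_of_norm_lt_one ((hpow N).trans_lt hN)
  have hcomm : Commute (1 - T) (∑ i ∈ Finset.range N, T ^ i) :=
    (mul_neg_geom_sum T N).trans (geom_sum_mul_neg T N).symm
  rw [← mul_neg_geom_sum] at hunit
  exact (hcomm.isUnit_mul_iff.1 hunit).1

end WeightedNorm

section IntervalIntegral

variable {V : Type*} [NormedAddCommGroup V] [NormedSpace ℝ V] {a b : ℝ}

theorem integral_eq_zero_of_Icc {f : ℝ → V} (hab : a ≤ b) (hf : ∀ s ∈ Icc a b, f s = 0) :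
    ∫ s in a..b, f s = 0 :=
  (intervalIntegral.integral_congr (uIcc_of_le hab ▸ hf)).trans intervalIntegral.integral_zero

theorem hasDerivAt_integral_of_lower_limit [CompleteSpace V] {f : ℝ → V}
    (hf : Continuous f) (b t : ℝ) : HasDerivAt (fun s => ∫ x in s..b, f x) (-f t) t := by
  simp only [intervalIntegral.integral_symm b]
  exact (hf.integral_hasStrictDerivAt b t).hasDerivAt.fun_neg

end IntervalIntegral

section PathOperators

variable {V W : Type*} [NormedAddCommGroup V] [NormedSpace ℝ V] [NormedAddCommGroup W]
  [NormedSpace ℝ W] {a b : ℝ}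

/-- The primitive vanishing at `c`, as an operator on paths over `[a, b]`. -/
def primitive (hab : a ≤ b) (c : ℝ) : C(Icc a b, W) →L[ℝ] C(Icc a b, W) :=
  LinearMap.mkContinuous
    { toFun := fun w => ⟨fun t => ∫ s in c..t, IccExtend hab w s,
        (intervalIntegral.continuous_primitive
          (fun _ _ => w.continuous.Icc_extend'.intervalIntegrable _ _) c).comp
            continuous_subtype_val⟩
      map_add' := fun w w' => by
        ext t
        exact intervalIntegral.integral_add (w.continuous.Icc_extend'.intervalIntegrable _ _)
          (w'.continuous.Icc_extend'.intervalIntegrable _ _)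
      map_smul' := fun r w => by
        ext t
        exact intervalIntegral.integral_smul r (IccExtend hab w) }
    (max |a - c| |b - c|) fun w => by
      refine (ContinuousMap.norm_le _ (by positivity)).2 fun t => ?_
      rw [mul_comm]
      refine (intervalIntegral.norm_integral_le_of_norm_le_const
        fun s _ => w.norm_coe_le_norm _).trans ?_
      gcongr
      exact abs_le_max_abs_abs (by linarith [t.2.1]) (by linarith [t.2.2])

theorem primitive_apply (hab : a ≤ b) (c : ℝ) (w : C(Icc a b, W)) (t : Icc a b) :
    primitive hab c w t = ∫ s in c..t, IccExtend hab w s := rfl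

theorem IccExtend_primitive (hab : a ≤ b) (c : ℝ) (w : C(Icc a b, W)) {s : ℝ}
    (hs : s ∈ Icc a b) :
    IccExtend hab (primitive hab c w) s = ∫ x in c..s, IccExtend hab w x := by
  rw [IccExtend_of_mem hab _ hs, primitive_apply]

/-- The integral of a path over all of `[a, b]`, as an operator. -/
def pathIntegral (hab : a ≤ b) : C(Icc a b, W) →L[ℝ] W :=
  ContinuousMap.evalCLM ℝ ⟨b, right_mem_Icc.2 hab⟩ ∘L primitive hab a

theorem primitive_left (hab : a ≤ b) (w : C(Icc a b, W)) :
    primitive hab a w ⟨a, left_mem_Icc.2 hab⟩ = 0 := by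
  rw [primitive_apply, intervalIntegral.integral_same]

/-- The integral over the remaining time `[t, b]`, as an operator on paths over `[a, b]`. -/
def tailIntegral (hab : a ≤ b) : C(Icc a b, W) →L[ℝ] C(Icc a b, W) := -primitive hab b

theorem tailIntegral_apply (hab : a ≤ b) (w : C(Icc a b, W)) (t : Icc a b) :
    tailIntegral hab w t = ∫ s in t..b, IccExtend hab w s :=
  (intervalIntegral.integral_symm _ _).symm

theorem IccExtend_tailIntegral (hab : a ≤ b) (w : C(Icc a b, W)) {s : ℝ} (hs : s ∈ Icc a b) :
    IccExtend hab (tailIntegral hab w) s = ∫ x in s..b, IccExtend hab w x := by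
  rw [IccExtend_of_mem hab _ hs, tailIntegral_apply]

theorem tailIntegral_right (hab : a ≤ b) (w : C(Icc a b, W)) :
    tailIntegral hab w ⟨b, right_mem_Icc.2 hab⟩ = 0 := by
  rw [tailIntegral_apply, intervalIntegral.integral_same]

/-- Translation of paths over `[a, b]`: the value at `t` is `w (t + r)`, where `w` is continued
beyond `[a, b]` by its end point values. -/
def shift (hab : a ≤ b) (r : ℝ) : C(Icc a b, W) →L[ℝ] C(Icc a b, W) :=
  ContinuousMap.compCLM ℝ W ⟨fun t => projIcc a b hab (t + r), by fun_prop⟩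

theorem shift_apply (hab : a ≤ b) (r : ℝ) (w : C(Icc a b, W)) (t : Icc a b) :
    shift hab r w t = IccExtend hab w (t + r) := rfl

theorem IccExtend_shift (hab : a ≤ b) (r : ℝ) (w : C(Icc a b, W)) {s : ℝ} (hs : s ∈ Icc a b) :
    IccExtend hab (shift hab r w) s = IccExtend hab w (s + r) := by
  rw [IccExtend_of_mem hab _ hs, shift_apply]

/-- A continuous family of operators, acting pointwise on paths. -/
def pointwise (D : C(Icc a b, V →L[ℝ] W)) : C(Icc a b, V) →L[ℝ] C(Icc a b, W) :=
  LinearMap.mkContinuous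
    { toFun := fun z => ⟨fun t => D t (z t), D.continuous.clm_apply z.continuous⟩
      map_add' := fun z z' => by ext t; simp
      map_smul' := fun c z => by ext t; simp }
    ‖D‖ fun z => (ContinuousMap.norm_le _ (by positivity)).2 fun t =>
      (D t).le_of_opNorm_le_of_le (D.norm_coe_le_norm t) (z.norm_coe_le_norm t)

@[simp]
theorem pointwise_apply (D : C(Icc a b, V →L[ℝ] W)) (z : C(Icc a b, V)) (t : Icc a b) :
    pointwise D z t = D t (z t) := rfl

end PathOperators

section DelayEquations

variable {W : Type*} [NormedAddCommGroup W] [NormedSpace ℝ W] {a b : ℝ} {κ M : ℝ}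

theorem norm_primitive_le_of_norm_le_exp (hab : a ≤ b) (hκ : 0 < κ) {w : C(Icc a b, W)}
    (hw : ∀ s, ‖w s‖ ≤ M * Real.exp (κ * (s - a))) (t : Icc a b) :
    ‖primitive hab a w t‖ ≤ M / κ * Real.exp (κ * (t - a)) := by
  have hM : 0 ≤ M := nonneg_of_mul_nonneg_left ((norm_nonneg _).trans (hw t)) (Real.exp_pos _)
  have hderiv : ∀ s : ℝ, HasDerivAt (fun s => M / κ * Real.exp (κ * (s - a)))
      (M * Real.exp (κ * (s - a))) s := fun s => by
    refine ((((hasDerivAt_id s).sub_const a).const_mul κ).exp.const_mul (M / κ)).congr_deriv ?_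
    simp only [id]
    field_simp
  calc ‖primitive hab a w t‖ ≤ ∫ s in a..t, M * Real.exp (κ * (s - a)) := by
        refine intervalIntegral.norm_integral_le_of_norm_le t.2.1 (ae_of_all _ fun s hs => ?_)
          (Continuous.intervalIntegrable (by fun_prop) _ _)
        rw [IccExtend_of_mem _ _ ⟨hs.1.le, hs.2.trans t.2.2⟩]
        exact hw _
    _ = M / κ * Real.exp (κ * (t - a)) - M / κ * Real.exp (κ * (a - a)) :=
        intervalIntegral.integral_eq_sub_of_hasDerivAt (fun s _ => hderiv s)
          (Continuous.intervalIntegrable (by fun_prop) _ _)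
    _ ≤ M / κ * Real.exp (κ * (t - a)) := sub_le_self _ (by positivity)

theorem norm_tailIntegral_le_of_norm_le_exp (hab : a ≤ b) (hκ : 0 < κ) {w : C(Icc a b, W)}
    (hw : ∀ s, ‖w s‖ ≤ M * Real.exp (κ * (b - s))) (t : Icc a b) :
    ‖tailIntegral hab w t‖ ≤ M / κ * Real.exp (κ * (b - t)) := by
  have hM : 0 ≤ M := nonneg_of_mul_nonneg_left ((norm_nonneg _).trans (hw t)) (Real.exp_pos _)
  have hderiv : ∀ s : ℝ, HasDerivAt (fun s => -(M / κ * Real.exp (κ * (b - s))))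
      (M * Real.exp (κ * (b - s))) s := fun s => by
    refine ((((hasDerivAt_id s).const_sub b).const_mul κ).exp.const_mul (M / κ)).neg.congr_deriv ?_
    simp only [id]
    field_simp
  rw [tailIntegral_apply]
  calc ‖∫ s in t..b, IccExtend hab w s‖ ≤ ∫ s in t..b, M * Real.exp (κ * (b - s)) := by
        refine intervalIntegral.norm_integral_le_of_norm_le t.2.2 (ae_of_all _ fun s hs => ?_)
          (Continuous.intervalIntegrable (by fun_prop) _ _)
        rw [IccExtend_of_mem _ _ ⟨t.2.1.trans hs.1.le, hs.2⟩]
        exact hw _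
    _ = -(M / κ * Real.exp (κ * (b - b))) - -(M / κ * Real.exp (κ * (b - t))) :=
        intervalIntegral.integral_eq_sub_of_hasDerivAt (fun s _ => hderiv s)
          (Continuous.intervalIntegrable (by fun_prop) _ _)
    _ ≤ M / κ * Real.exp (κ * (b - t)) := by
        rw [neg_sub_neg]
        exact sub_le_self _ (by positivity)

theorem norm_pointwise_apply_le (A : C(Icc a b, W →L[ℝ] W)) {w : C(Icc a b, W)} {t : Icc a b}
    {C : ℝ} (hw : ‖w t‖ ≤ C) : ‖pointwise A w t‖ ≤ ‖A‖ * C :=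
  (A t).le_of_opNorm_le_of_le (A.norm_coe_le_norm t) hw

theorem norm_shift_apply_le_of_monotone (hab : a ≤ b) {r : ℝ} (hr : r ≤ 0) {w : C(Icc a b, W)}
    {ρ : Icc a b → ℝ} (hρ : Monotone ρ) (hw : ∀ s, ‖w s‖ ≤ ρ s) (t : Icc a b) :
    ‖shift hab r w t‖ ≤ ρ t :=
  (hw _).trans <| hρ <|
    (monotone_projIcc hab (add_le_of_nonpos_right hr)).trans_eq (projIcc_val hab t)

theorem norm_shift_apply_le_of_antitone (hab : a ≤ b) {r : ℝ} (hr : 0 ≤ r) {w : C(Icc a b, W)}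
    {ρ : Icc a b → ℝ} (hρ : Antitone ρ) (hw : ∀ s, ‖w s‖ ≤ ρ s) (t : Icc a b) :
    ‖shift hab r w t‖ ≤ ρ t :=
  (hw _).trans <| hρ <|
    (projIcc_val hab t).symm.trans_le (monotone_projIcc hab (le_add_of_nonneg_right hr))

variable [CompleteSpace W]

theorem exists_solution_retarded (hab : a ≤ b) {τ : ℝ} (hτ : 0 ≤ τ)
    (A B : C(Icc a b, W →L[ℝ] W)) (r : C(Icc a b, W)) :
    ∃ h, h - primitive hab a (pointwise A h + pointwise B (shift hab (-τ) h)) = r := by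
  let κ := 2 * (‖A‖ + ‖B‖) + 1
  have hκ : 0 < κ := by positivity
  let σ : C(Icc a b, ℝ) := ⟨fun t => Real.exp (κ * (t - a)), by fun_prop⟩
  let T := primitive hab a ∘L (pointwise A + pointwise B ∘L shift hab (-τ))
  have hT : ∀ (w : C(Icc a b, W)) (M : ℝ), (∀ s, ‖w s‖ ≤ M * σ s) →
      ∀ t, ‖T w t‖ ≤ 1 / 2 * M * σ t := by
    intro w M hw t
    have hM : 0 ≤ M := nonneg_of_mul_nonneg_left ((norm_nonneg _).trans (hw t)) (Real.exp_pos _)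
    have hmono : Monotone fun s => M * σ s := fun s s' hs =>
      mul_le_mul_of_nonneg_left (Real.exp_le_exp.2 (by gcongr)) hM
    have hbound : ∀ s, ‖(pointwise A w + pointwise B (shift hab (-τ) w)) s‖ ≤
        (‖A‖ + ‖B‖) * M * Real.exp (κ * (s - a)) := fun s =>
      (norm_add_le_of_le (norm_pointwise_apply_le A (hw s)) (norm_pointwise_apply_le B
        (norm_shift_apply_le_of_monotone hab (neg_nonpos.2 hτ) hmono hw s))).trans_eq (by
          rw [← add_mul, mul_assoc]
          rfl)
    refine (norm_primitive_le_of_norm_le_exp hab hκ hbound t).trans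
      (mul_le_mul_of_nonneg_right ?_ (Real.exp_pos _).le)
    rw [div_le_iff₀ hκ]
    nlinarith
  have hunit : IsUnit (1 - T) := isUnit_one_sub_of_weighted
    (fun t => Real.one_le_exp (mul_nonneg hκ.le (sub_nonneg.2 t.2.1))) (by norm_num)
    (by norm_num) hT
  exact (ContinuousLinearMap.isUnit_iff_bijective.1 hunit).2 r

theorem exists_solution_advanced (hab : a ≤ b) {τ : ℝ} (hτ : 0 ≤ τ)
    (A B : C(Icc a b, W →L[ℝ] W)) (r : C(Icc a b, W)) :
    ∃ p, p - (tailIntegral hab (pointwise A p) +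
      shift hab τ (tailIntegral hab (pointwise B p))) = r := by
  let κ := 2 * (‖A‖ + ‖B‖) + 1
  have hκ : 0 < κ := by positivity
  let σ : C(Icc a b, ℝ) := ⟨fun t => Real.exp (κ * (b - t)), by fun_prop⟩
  let T := tailIntegral hab ∘L pointwise A + shift hab τ ∘L tailIntegral hab ∘L pointwise B
  have hT : ∀ (w : C(Icc a b, W)) (M : ℝ), (∀ s, ‖w s‖ ≤ M * σ s) →
      ∀ t, ‖T w t‖ ≤ 1 / 2 * M * σ t := by
    intro w M hw t
    have hM : 0 ≤ M := nonneg_of_mul_nonneg_left ((norm_nonneg _).trans (hw t)) (Real.exp_pos _)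
    have htail : ∀ (D : C(Icc a b, W →L[ℝ] W)) (s : Icc a b),
        ‖tailIntegral hab (pointwise D w) s‖ ≤ ‖D‖ * M / κ * σ s := fun D =>
      norm_tailIntegral_le_of_norm_le_exp hab hκ fun s =>
        (norm_pointwise_apply_le D (hw s)).trans_eq (mul_assoc _ _ _).symm
    have hanti : Antitone fun s => ‖B‖ * M / κ * σ s := fun s s' hs =>
      mul_le_mul_of_nonneg_left (Real.exp_le_exp.2 (by gcongr)) (by positivity)
    calc ‖T w t‖ ≤ ‖A‖ * M / κ * σ t + ‖B‖ * M / κ * σ t :=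
          norm_add_le_of_le (htail A t) (norm_shift_apply_le_of_antitone hab hτ hanti (htail B) t)
      _ = (‖A‖ + ‖B‖) * M / κ * σ t := by ring
      _ ≤ 1 / 2 * M * σ t := by
          refine mul_le_mul_of_nonneg_right ?_ (Real.exp_pos _).le
          rw [div_le_iff₀ hκ]
          nlinarith
  have hunit : IsUnit (1 - T) := isUnit_one_sub_of_weighted
    (fun t => Real.one_le_exp (mul_nonneg hκ.le (sub_nonneg.2 t.2.2))) (by norm_num)
    (by norm_num) hT
  exact (ContinuousLinearMap.isUnit_iff_bijective.1 hunit).2 r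

end DelayEquations

section Superposition

section Continuous

variable {Z W : Type*} [TopologicalSpace Z] [TopologicalSpace W] {a b : ℝ} {f : ℝ × Z → W}

/-- The superposition (Nemytskii) operator `z ↦ f (·, z ·)` on paths over `[a, b]`. -/
def nemytskii (f : ℝ × Z → W) (hf : ContinuousOn f (Icc a b ×ˢ univ)) (z : C(Icc a b, Z)) :
    C(Icc a b, W) :=
  ⟨fun t => f (t, z t), hf.comp_continuous (by fun_prop) fun t => ⟨t.2, mem_univ _⟩⟩

@[simp]
theorem nemytskii_apply (hf : ContinuousOn f (Icc a b ×ˢ univ)) (z : C(Icc a b, Z))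
    (t : Icc a b) : nemytskii f hf z t = f (t, z t) := rfl

end Continuous

variable {Z W : Type*} [NormedAddCommGroup Z] [NormedSpace ℝ Z] [NormedAddCommGroup W]
  [NormedSpace ℝ W] {a b : ℝ} {f : ℝ × Z → W}

/-- The partial derivative of `f (t, y)` in `y`. -/
def fderivSnd (f : ℝ × Z → W) (x : ℝ × Z) : Z →L[ℝ] W := fderiv ℝ (fun y => f (x.1, y)) x.2

theorem hasFDerivAt_snd_fderivWithin (hf : ContDiffOn ℝ 1 f (Icc a b ×ˢ univ)) {t : ℝ}
    (ht : t ∈ Icc a b) (y : Z) :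
    HasFDerivAt (fun y => f (t, y))
      (fderivWithin ℝ f (Icc a b ×ˢ univ) (t, y) ∘L .inr ℝ ℝ Z) y :=
  hasFDerivWithinAt_univ.1 <|
    (hf.differentiableOn one_ne_zero (t, y) ⟨ht, mem_univ _⟩).hasFDerivWithinAt.comp y
      (hasFDerivAt_prodMk_right t y).hasFDerivWithinAt fun y _ => ⟨ht, mem_univ y⟩

theorem hasFDerivAt_fderivSnd (hf : ContDiffOn ℝ 1 f (Icc a b ×ˢ univ)) {t : ℝ}
    (ht : t ∈ Icc a b) (y : Z) : HasFDerivAt (fun y => f (t, y)) (fderivSnd f (t, y)) y :=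
  (hasFDerivAt_snd_fderivWithin hf ht y).differentiableAt.hasFDerivAt

theorem continuousOn_fderivSnd (hab : a < b) (hf : ContDiffOn ℝ 1 f (Icc a b ×ˢ univ)) :
    ContinuousOn (fderivSnd f) (Icc a b ×ˢ univ) :=
  ((hf.continuousOn_fderivWithin ((uniqueDiffOn_Icc hab).prod uniqueDiffOn_univ) le_rfl).clm_comp
    continuousOn_const).congr fun x hx => (hasFDerivAt_snd_fderivWithin hf hx.1 x.2).fderiv

/-- The derivative of `f` along the path `z`, in the directions of the second variable. -/
def fderivAlong (hab : a < b) (hf : ContDiffOn ℝ 1 f (Icc a b ×ˢ univ)) (z : C(Icc a b, Z)) :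
    C(Icc a b, Z →L[ℝ] W) :=
  nemytskii (fderivSnd f) (continuousOn_fderivSnd hab hf) z

theorem hasFDerivAt_fderivAlong (hab : a < b) (hf : ContDiffOn ℝ 1 f (Icc a b ×ˢ univ))
    (z : C(Icc a b, Z)) (t : Icc a b) :
    HasFDerivAt (fun y => f (t, y)) (fderivAlong hab hf z t) (z t) :=
  hasFDerivAt_fderivSnd hf t.2 (z t)

theorem eventually_norm_fderivSnd_add_sub_lt (hab : a < b)
    (hf : ContDiffOn ℝ 1 f (Icc a b ×ˢ univ)) (z : C(Icc a b, Z)) {c : ℝ} (hc : 0 < c) :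
    ∀ᶠ d in 𝓝 (0 : Z), ∀ t : Icc a b,
      ‖fderivSnd f (t, z t + d) - fderivAlong hab hf z t‖ < c := by
  have hcont : Continuous fun x : Z × Icc a b =>
      ‖fderivSnd f (x.2, z x.2 + x.1) - fderivAlong hab hf z x.2‖ :=
    (((continuousOn_fderivSnd hab hf).comp_continuous (by fun_prop)
      fun x => ⟨x.2.2, mem_univ _⟩).sub
        ((fderivAlong hab hf z).continuous.comp continuous_snd)).norm
  have hlt : ∀ᶠ d in 𝓝 (0 : Z), ∀ t ∈ (univ : Set (Icc a b)),
      ‖fderivSnd f (t, z t + d) - fderivAlong hab hf z t‖ < c := by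
    refine isCompact_univ.eventually_forall_of_forall_eventually fun t _ => ?_
    refine hcont.continuousAt.eventually_lt continuousAt_const ?_
    simpa [fderivAlong] using hc
  simpa only [mem_univ, true_implies] using hlt

theorem hasStrictFDerivAt_nemytskii (hab : a < b) (hf : ContDiffOn ℝ 1 f (Icc a b ×ˢ univ))
    (z : C(Icc a b, Z)) :
    HasStrictFDerivAt (nemytskii f hf.continuousOn) (pointwise (fderivAlong hab hf z)) z := by
  rw [hasStrictFDerivAt_iff_isLittleO, Asymptotics.isLittleO_iff]
  intro c hc
  obtain ⟨r, hr, hball⟩ := Metric.eventually_nhds_iff.1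
    (eventually_norm_fderivSnd_add_sub_lt hab hf z hc)
  filter_upwards [prod_mem_nhds (Metric.ball_mem_nhds z hr) (Metric.ball_mem_nhds z hr)]
    with x hx
  refine (ContinuousMap.norm_le _ (by positivity)).2 fun t => ?_
  have hmem : ∀ y ∈ Metric.ball z r, y t ∈ Metric.ball (z t) r := fun y hy =>
    (ContinuousMap.dist_apply_le_dist t).trans_lt hy
  have hderiv : ∀ y ∈ Metric.ball (z t) r,
      ‖fderivSnd f (t, y) - fderivAlong hab hf z t‖ ≤ c := fun y hy => by
    simpa using (hball (y := y - z t) (by simpa [dist_eq_norm] using hy) t).le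
  calc _ ≤ c * ‖x.1 t - x.2 t‖ :=
        (convex_ball (z t) r).norm_image_sub_le_of_norm_hasFDerivWithin_le'
          (fun y _ => (hasFDerivAt_fderivSnd hf t.2 y).hasFDerivWithinAt) hderiv
          (hmem x.2 hx.2) (hmem x.1 hx.1)
    _ ≤ c * ‖x.1 - x.2‖ := by gcongr; exact (x.1 - x.2).norm_coe_le_norm t

end Superposition

section Pairing

variable {V : Type*} [NormedAddCommGroup V] [InnerProductSpace ℝ V] {a b τ : ℝ}

/-- The `L²` inner product of paths over `[a, b]`. -/
def pairing (hab : a ≤ b) (f g : C(Icc a b, V)) : ℝ :=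
  ∫ s in a..b, inner ℝ (IccExtend hab f s) (IccExtend hab g s)

theorem intervalIntegrable_inner_IccExtend (hab : a ≤ b) (f g : C(Icc a b, V)) (c d : ℝ) :
    IntervalIntegrable (fun s => inner ℝ (IccExtend hab f s) (IccExtend hab g s)) volume c d :=
  (f.continuous.Icc_extend'.inner g.continuous.Icc_extend').intervalIntegrable _ _

theorem pairing_add_left (hab : a ≤ b) (f f' g : C(Icc a b, V)) :
    pairing hab (f + f') g = pairing hab f g + pairing hab f' g := by
  unfold pairing
  rw [← intervalIntegral.integral_add (intervalIntegrable_inner_IccExtend hab f g a b)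
    (intervalIntegrable_inner_IccExtend hab f' g a b)]
  exact intervalIntegral.integral_congr fun s _ => inner_add_left _ _ _

theorem pairing_shift_left (hab : a ≤ b) (hτ : 0 ≤ τ) (hτ' : τ ≤ b - a) {f : C(Icc a b, V)}
    (hf : f ⟨b, right_mem_Icc.2 hab⟩ = 0) (g : C(Icc a b, V)) :
    pairing hab (shift hab τ f) g =
      ∫ s in a..(b - τ), inner ℝ (IccExtend hab f (s + τ)) (IccExtend hab g s) := by
  have hint := intervalIntegrable_inner_IccExtend hab (shift hab τ f) g
  have htail : ∫ s in (b - τ)..b,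
      inner ℝ (IccExtend hab (shift hab τ f) s) (IccExtend hab g s) = 0 :=
    integral_eq_zero_of_Icc (by linarith) fun s hs => by
      rw [IccExtend_shift hab τ f ⟨by linarith [hs.1], hs.2⟩,
        IccExtend_of_right_le hab f (by linarith [hs.1]), hf, inner_zero_left]
  rw [pairing, ← intervalIntegral.integral_add_adjacent_intervals (hint a (b - τ)) (hint _ b),
    htail, add_zero]
  refine intervalIntegral.integral_congr fun s hs => ?_
  rw [uIcc_of_le (by linarith)] at hs
  simp only [IccExtend_shift hab τ f ⟨hs.1, by linarith [hs.2]⟩]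

theorem pairing_shift_right (hab : a ≤ b) (hτ : 0 ≤ τ) (hτ' : τ ≤ b - a) (f : C(Icc a b, V))
    {g : C(Icc a b, V)} (hg : g ⟨a, left_mem_Icc.2 hab⟩ = 0) :
    pairing hab f (shift hab (-τ) g) =
      ∫ s in a..(b - τ), inner ℝ (IccExtend hab f (s + τ)) (IccExtend hab g s) := by
  have hint := intervalIntegrable_inner_IccExtend hab f (shift hab (-τ) g)
  have hhead : ∫ s in a..(a + τ),
      inner ℝ (IccExtend hab f s) (IccExtend hab (shift hab (-τ) g) s) = 0 :=
    integral_eq_zero_of_Icc (by linarith) fun s hs => by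
      rw [IccExtend_shift hab _ g ⟨hs.1, by linarith [hs.2]⟩,
        IccExtend_of_le_left hab g (by linarith [hs.2]), hg, inner_zero_right]
  have hsub := intervalIntegral.integral_comp_add_right (a := a) (b := b - τ)
    (fun s => inner ℝ (IccExtend hab f s) (IccExtend hab (shift hab (-τ) g) s)) τ
  rw [sub_add_cancel] at hsub
  rw [pairing, ← intervalIntegral.integral_add_adjacent_intervals (hint a (a + τ)) (hint _ b),
    hhead, zero_add, ← hsub]
  refine intervalIntegral.integral_congr fun s hs => ?_
  rw [uIcc_of_le (by linarith)] at hs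
  simp only [IccExtend_shift hab _ g (s := s + τ) ⟨by linarith [hs.1], by linarith [hs.2]⟩,
    add_neg_cancel_right]

variable [CompleteSpace V]

theorem integral_inner_primitive_eq {f g : ℝ → V} (hf : Continuous f) (hg : Continuous g)
    (a b : ℝ) :
    ∫ s in a..b, inner ℝ (∫ x in s..b, f x) (g s) =
      ∫ s in a..b, inner ℝ (f s) (∫ x in a..s, g x) := by
  have hF := hasDerivAt_integral_of_lower_limit hf b
  have hG : ∀ t, HasDerivAt (fun s => ∫ x in a..s, g x) (g t) t := fun t =>
    (hg.integral_hasStrictDerivAt a t).hasDerivAt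
  have : Continuous fun s => ∫ x in s..b, f x :=
    continuous_iff_continuousAt.2 fun t => (hF t).continuousAt
  have : Continuous fun s => ∫ x in a..s, g x :=
    continuous_iff_continuousAt.2 fun t => (hG t).continuousAt
  have h := intervalIntegral.integral_eq_sub_of_hasDerivAt (a := a) (b := b)
    (fun t _ => (hF t).inner ℝ (hG t)) (Continuous.intervalIntegrable (by fun_prop) _ _)
  rw [intervalIntegral.integral_add (Continuous.intervalIntegrable (by fun_prop) _ _)
    (Continuous.intervalIntegrable (by fun_prop) _ _)] at h
  simp only [intervalIntegral.integral_same, inner_zero_left, inner_zero_right, sub_zero,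
    inner_neg_left, intervalIntegral.integral_neg] at h
  linarith

theorem pairing_tailIntegral_left (hab : a ≤ b) (f g : C(Icc a b, V)) :
    pairing hab (tailIntegral hab f) g = pairing hab f (primitive hab a g) := by
  calc pairing hab (tailIntegral hab f) g
      = ∫ s in a..b, inner ℝ (∫ x in s..b, IccExtend hab f x) (IccExtend hab g s) :=
        intervalIntegral.integral_congr fun s hs => by
          simp only [IccExtend_tailIntegral hab f (uIcc_of_le hab ▸ hs)]
    _ = ∫ s in a..b, inner ℝ (IccExtend hab f s) (∫ x in a..s, IccExtend hab g x) :=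
        integral_inner_primitive_eq f.continuous.Icc_extend' g.continuous.Icc_extend' a b
    _ = pairing hab f (primitive hab a g) :=
        intervalIntegral.integral_congr fun s hs => by
          simp only [IccExtend_primitive hab a g (uIcc_of_le hab ▸ hs)]

theorem pairing_shift_tailIntegral_left (hab : a ≤ b) (hτ : 0 ≤ τ) (hτ' : τ ≤ b - a)
    (f g : C(Icc a b, V)) :
    pairing hab (shift hab τ (tailIntegral hab f)) g =
      pairing hab f (shift hab (-τ) (primitive hab a g)) := by
  rw [pairing_shift_left hab hτ hτ' (tailIntegral_right hab f),
    pairing_shift_right hab hτ hτ' f (primitive_left hab g)]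
  have hle : a ≤ b - τ := by linarith
  calc ∫ s in a..(b - τ), inner ℝ (IccExtend hab (tailIntegral hab f) (s + τ)) (IccExtend hab g s)
      = ∫ s in a..(b - τ), inner ℝ (∫ x in s..(b - τ), IccExtend hab f (x + τ))
          (IccExtend hab g s) :=
        intervalIntegral.integral_congr fun s hs => by
          rw [uIcc_of_le hle] at hs
          simp only [intervalIntegral.integral_comp_add_right, sub_add_cancel,
            IccExtend_tailIntegral hab f (s := s + τ)
              ⟨by linarith [hs.1], by linarith [hs.2]⟩]
    _ = ∫ s in a..(b - τ), inner ℝ (IccExtend hab f (s + τ)) (∫ x in a..s, IccExtend hab g x) :=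
        integral_inner_primitive_eq
          (f.continuous.Icc_extend'.comp (continuous_add_const τ)) g.continuous.Icc_extend' a _
    _ = _ := intervalIntegral.integral_congr fun s hs => by
          rw [uIcc_of_le hle] at hs
          simp only [IccExtend_primitive hab a g (s := s) ⟨hs.1, by linarith [hs.2]⟩]

end Pairing

section FundamentalLemma

variable {V : Type*} [NormedAddCommGroup V] [InnerProductSpace ℝ V] {a b τ : ℝ}

theorem eqOn_zero_of_forall_integral_inner_eq_zero (hab : a < b) {F : ℝ → V} (hF : Continuous F)
    (h : ∀ v : C(ℝ, V), (∀ s ∉ Ioo a b, v s = 0) → ∫ s in a..b, inner ℝ (F s) (v s) = 0) :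
    ∀ s ∈ Icc a b, F s = 0 := by
  have hbump_pos : ∀ s ∈ Ioo a b, 0 < max 0 ((s - a) * (b - s)) := fun s hs =>
    lt_max_of_lt_right (mul_pos (sub_pos.2 hs.1) (sub_pos.2 hs.2))
  have hbump_zero : ∀ s ∉ Ioo a b, max 0 ((s - a) * (b - s)) = 0 := fun s hs => by
    refine max_eq_left (not_lt.1 fun hpos => hs ?_)
    rcases pos_and_pos_or_neg_and_neg_of_mul_pos hpos with hs' | hs'
    · exact ⟨by linarith [hs'.1], by linarith [hs'.2]⟩
    · linarith [hs'.1, hs'.2]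
  have hopen : ∀ s ∈ Ioo a b, F s = 0 := by
    by_contra! hne
    obtain ⟨s, hs, hFs⟩ := hne
    have hint := h ⟨fun x => max 0 ((x - a) * (b - x)) • F x, by fun_prop⟩ fun x hx => by
      simp only [ContinuousMap.coe_mk, hbump_zero x hx, zero_smul]
    simp only [ContinuousMap.coe_mk, inner_smul_right, real_inner_self_eq_norm_sq] at hint
    refine (intervalIntegral.integral_pos hab (Continuous.continuousOn (by fun_prop))
      (fun x _ => by positivity) ⟨s, Ioo_subset_Icc_self hs, ?_⟩).ne' hint
    exact mul_pos (hbump_pos s hs) (by positivity)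
  intro s hs
  rw [← closure_Ioo hab.ne] at hs
  exact closure_minimal hopen (isClosed_eq hF continuous_const) hs

theorem pairing_add_pairing_shift (hab : a ≤ b) (hτ : 0 ≤ τ) (hτ' : τ ≤ b - a)
    (γ ε : C(Icc a b, V)) {v : C(Icc a b, V)} (hv : v ⟨a, left_mem_Icc.2 hab⟩ = 0) :
    pairing hab γ v + pairing hab ε (shift hab (-τ) v) =
      (∫ s in a..(b - τ), inner ℝ (IccExtend hab γ s + IccExtend hab ε (s + τ))
        (IccExtend hab v s)) +
      ∫ s in (b - τ)..b, inner ℝ (IccExtend hab γ s) (IccExtend hab v s) := by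
  have hγ := intervalIntegrable_inner_IccExtend hab γ v
  have hε : IntervalIntegrable (fun s => inner ℝ (IccExtend hab ε (s + τ)) (IccExtend hab v s))
      volume a (b - τ) :=
    ((ε.continuous.Icc_extend'.comp (continuous_add_const τ)).inner
      v.continuous.Icc_extend').intervalIntegrable _ _
  simp only [inner_add_left]
  rw [pairing_shift_right hab hτ hτ' ε hv, pairing, intervalIntegral.integral_add (hγ _ _) hε,
    ← intervalIntegral.integral_add_adjacent_intervals (hγ a (b - τ)) (hγ _ b)]
  ring

theorem eq_zero_of_forall_pairing_add_pairing_shift_eq_zero (hab : a ≤ b) (hτ : 0 < τ)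
    (hτ' : τ < b - a) {γ ε : C(Icc a b, V)}
    (h : ∀ v : C(Icc a b, V), v ⟨a, left_mem_Icc.2 hab⟩ = 0 →
      pairing hab γ v + pairing hab ε (shift hab (-τ) v) = 0) :
    (∀ s ∈ Icc a (b - τ), IccExtend hab γ s + IccExtend hab ε (s + τ) = 0) ∧
      ∀ s ∈ Icc (b - τ) b, IccExtend hab γ s = 0 := by
  have hsplit : ∀ v : C(ℝ, V), v a = 0 →
      (∫ s in a..(b - τ), inner ℝ (IccExtend hab γ s + IccExtend hab ε (s + τ)) (v s)) +
        ∫ s in (b - τ)..b, inner ℝ (IccExtend hab γ s) (v s) = 0 := fun v hv => by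
    have hext : ∀ s ∈ Icc a b, IccExtend hab (v.restrict (Icc a b)) s = v s := fun s hs =>
      IccExtend_of_mem hab _ hs
    rw [← h (v.restrict (Icc a b)) hv, pairing_add_pairing_shift hab hτ.le hτ'.le γ ε hv]
    congr 1 <;> refine intervalIntegral.integral_congr fun s hs => ?_ <;>
      rw [uIcc_of_le (by linarith)] at hs
    · simp only [hext s ⟨hs.1, by linarith [hs.2]⟩]
    · simp only [hext s ⟨by linarith [hs.1], hs.2⟩]
  have hvanish : ∀ {c d : ℝ} (F : ℝ → V) {v : ℝ → V}, c ≤ d → (∀ s ∈ Icc c d, v s = 0) →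
      ∫ s in c..d, inner ℝ (F s) (v s) = 0 := fun F v hcd hv =>
    integral_eq_zero_of_Icc hcd fun s hs => by rw [hv s hs, inner_zero_right]
  have cγ : Continuous (IccExtend hab γ) := γ.continuous.Icc_extend'
  have : Continuous (IccExtend hab ε) := ε.continuous.Icc_extend'
  constructor
  · refine eqOn_zero_of_forall_integral_inner_eq_zero (by linarith) (by fun_prop) fun v hv => ?_
    have hv_right : ∫ s in (b - τ)..b, inner ℝ (IccExtend hab γ s) (v s) = 0 :=
      hvanish _ (by linarith) fun s hs => hv s fun hs' => hs'.2.not_ge hs.1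
    simpa only [hv_right, add_zero] using hsplit v (hv a fun ha => ha.1.false)
  · refine eqOn_zero_of_forall_integral_inner_eq_zero (by linarith) cγ fun v hv => ?_
    have hv_left : ∀ s ∈ Icc a (b - τ), v s = 0 := fun s hs =>
      hv s fun hs' => hs'.1.not_ge hs.2
    simpa only [hvanish _ (by linarith) hv_left, zero_add] using
      hsplit v (hv_left a ⟨le_rfl, by linarith⟩)

end FundamentalLemma

section LinearMaximumPrinciple

variable {V X Y Z W : Type*} [NormedAddCommGroup V] [NormedAddCommGroup X]
  [InnerProductSpace ℝ X] [NormedAddCommGroup Y] [InnerProductSpace ℝ Y] [NormedAddCommGroup Z]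
  [NormedSpace ℝ Z] [NormedAddCommGroup W] [NormedSpace ℝ W] {a b τ : ℝ}

section Lift

variable [NormedSpace ℝ V]

/-- The path `ι (w t) + κ (w (t - τ))`: the contribution of `w` to the argument of a functional
which sees the current value of `w` through `ι` and the delayed one through `κ`. -/
def delayLift (hab : a ≤ b) (τ : ℝ) (ι κ : V →L[ℝ] Z) : C(Icc a b, V) →L[ℝ] C(Icc a b, Z) :=
  ι.compLeftContinuous ℝ _ + κ.compLeftContinuous ℝ _ ∘L shift hab (-τ)

theorem delayLift_apply (hab : a ≤ b) (τ : ℝ) (ι κ : V →L[ℝ] Z) (w : C(Icc a b, V))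
    (t : Icc a b) :
    delayLift hab τ ι κ w t = ι (w t) + κ (IccExtend hab w (t - τ)) := rfl

/-- The partial derivative, in the directions of `ι`, when `D` is the derivative along a path. -/
def precomp (ι : V →L[ℝ] Z) (D : C(Icc a b, Z →L[ℝ] W)) : C(Icc a b, V →L[ℝ] W) :=
  ⟨fun t => D t ∘L ι, D.continuous.clm_comp continuous_const⟩

theorem pointwise_delayLift (hab : a ≤ b) (τ : ℝ) (ι κ : V →L[ℝ] Z)
    (D : C(Icc a b, Z →L[ℝ] W)) (w : C(Icc a b, V)) :
    pointwise D (delayLift hab τ ι κ w) =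
      pointwise (precomp ι D) w + pointwise (precomp κ D) (shift hab (-τ) w) := by
  ext t
  exact map_add (D t) _ _

end Lift

section Gradient

variable [InnerProductSpace ℝ V] [CompleteSpace V]

/-- The path of Riesz representatives of a path of linear forms. -/
def rieszPath (l : C(Icc a b, V →L[ℝ] ℝ)) : C(Icc a b, V) :=
  ⟨fun t => (InnerProductSpace.toDual ℝ V).symm (l t),
    (InnerProductSpace.toDual ℝ V).symm.continuous.comp l.continuous⟩

theorem inner_rieszPath (l : C(Icc a b, V →L[ℝ] ℝ)) (t : Icc a b) (v : V) :
    inner ℝ (rieszPath l t) v = l t v :=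
  InnerProductSpace.toDual_symm_apply

theorem pathIntegral_pointwise_eq_pairing (hab : a ≤ b) (l : C(Icc a b, V →L[ℝ] ℝ))
    (w : C(Icc a b, V)) : pathIntegral hab (pointwise l w) = pairing hab (rieszPath l) w :=
  intervalIntegral.integral_congr fun _ _ => (inner_rieszPath l _ _).symm

theorem pathIntegral_pointwise_delayLift (hab : a ≤ b) (τ : ℝ) (ι κ : V →L[ℝ] Z)
    (l : C(Icc a b, Z →L[ℝ] ℝ)) (w : C(Icc a b, V)) :
    pathIntegral hab (pointwise l (delayLift hab τ ι κ w)) =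
      pairing hab (rieszPath (precomp ι l)) w +
        pairing hab (rieszPath (precomp κ l)) (shift hab (-τ) w) := by
  rw [pointwise_delayLift, map_add, pathIntegral_pointwise_eq_pairing,
    pathIntegral_pointwise_eq_pairing]

end Gradient

/-- The derivative `Λ + p · D` of the Hamiltonian along a path, where `Λ` and `D` are those of the
Lagrangian and the velocity. -/
def hamiltonianForm (Λ : C(Icc a b, Z →L[ℝ] ℝ)) (D : C(Icc a b, Z →L[ℝ] X)) (p : C(Icc a b, X)) :
    C(Icc a b, Z →L[ℝ] ℝ) :=
  ⟨fun t => Λ t + innerSL ℝ (p t) ∘L D t,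
    Λ.continuous.add (((innerSL ℝ).continuous.comp p.continuous).clm_comp D.continuous)⟩

theorem pathIntegral_pointwise_hamiltonianForm (hab : a ≤ b) (Λ : C(Icc a b, Z →L[ℝ] ℝ))
    (D : C(Icc a b, Z →L[ℝ] X)) (p : C(Icc a b, X)) (x : C(Icc a b, Z)) :
    pathIntegral hab (pointwise (hamiltonianForm Λ D p) x) =
      pathIntegral hab (pointwise Λ x) + pairing hab p (pointwise D x) :=
  intervalIntegral.integral_add ((pointwise Λ x).continuous.Icc_extend'.intervalIntegrable _ _)
    (intervalIntegrable_inner_IccExtend hab p (pointwise D x) a b)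

variable [CompleteSpace X]

/-- The path of adjoints of a path of operators. -/
def adjointPath [InnerProductSpace ℝ V] [CompleteSpace V] (A : C(Icc a b, V →L[ℝ] X)) :
    C(Icc a b, X →L[ℝ] V) :=
  ⟨fun t => ContinuousLinearMap.adjoint (A t),
    ContinuousLinearMap.adjoint.continuous.comp A.continuous⟩

theorem rieszPath_precomp_hamiltonianForm [InnerProductSpace ℝ V] [CompleteSpace V] (ι : V →L[ℝ] Z)
    (Λ : C(Icc a b, Z →L[ℝ] ℝ)) (D : C(Icc a b, Z →L[ℝ] X)) (p : C(Icc a b, X)) :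
    rieszPath (precomp ι (hamiltonianForm Λ D p)) =
      rieszPath (precomp ι Λ) + pointwise (adjointPath (precomp ι D)) p := by
  ext1 t
  refine ext_inner_right ℝ fun v => ?_
  rw [ContinuousMap.add_apply, inner_add_left, inner_rieszPath, inner_rieszPath]
  exact congrArg _ (ContinuousLinearMap.adjoint_inner_left (D t ∘L ι) v (p t)).symm

/-- `p` solves the integrated costate equation `p' (t) = -∂H (t) - ∂_τ H (t + τ)`, `p b = 0`, where
`H` is `hamiltonianForm Λ D p`, and `∂`, `∂_τ` are its gradients in the directions of `ι` (current
state) and `κ` (delayed state). -/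
def IsCostate (hab : a ≤ b) (τ : ℝ) (ι κ : X →L[ℝ] Z) (Λ : C(Icc a b, Z →L[ℝ] ℝ))
    (D : C(Icc a b, Z →L[ℝ] X)) (p : C(Icc a b, X)) : Prop :=
  p = tailIntegral hab (rieszPath (precomp ι (hamiltonianForm Λ D p))) +
    shift hab τ (tailIntegral hab (rieszPath (precomp κ (hamiltonianForm Λ D p))))

theorem exists_isCostate (hab : a ≤ b) (hτ : 0 ≤ τ) (ι κ : X →L[ℝ] Z)
    (Λ : C(Icc a b, Z →L[ℝ] ℝ)) (D : C(Icc a b, Z →L[ℝ] X)) :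
    ∃ p, IsCostate hab τ ι κ Λ D p := by
  obtain ⟨p, hp⟩ := exists_solution_advanced hab hτ (adjointPath (precomp ι D))
    (adjointPath (precomp κ D)) (tailIntegral hab (rieszPath (precomp ι Λ)) +
      shift hab τ (tailIntegral hab (rieszPath (precomp κ Λ))))
  refine ⟨p, (sub_eq_iff_eq_add.1 hp).trans ?_⟩
  simp only [rieszPath_precomp_hamiltonianForm, map_add]
  abel

variable {hab : a ≤ b} {ι κ : X →L[ℝ] Z} {Λ : C(Icc a b, Z →L[ℝ] ℝ)} {D : C(Icc a b, Z →L[ℝ] X)}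
  {p : C(Icc a b, X)}

namespace IsCostate

theorem pathIntegral_hamiltonianForm_state (hp : IsCostate hab τ ι κ Λ D p) (hτ : 0 ≤ τ)
    (hτ' : τ ≤ b - a) (w : C(Icc a b, X)) :
    pathIntegral hab (pointwise (hamiltonianForm Λ D p)
      (delayLift hab τ ι κ (primitive hab a w))) = pairing hab p w := by
  rw [pathIntegral_pointwise_delayLift, ← pairing_tailIntegral_left,
    ← pairing_shift_tailIntegral_left hab hτ hτ', ← pairing_add_left, ← hp]

variable [CompleteSpace Y]

theorem pathIntegral_eq_control_variation (hp : IsCostate hab τ ι κ Λ D p) (hτ : 0 ≤ τ)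
    (hτ' : τ ≤ b - a) (ι' κ' : Y →L[ℝ] Z) {h : C(Icc a b, X)} {v : C(Icc a b, Y)}
    (hh : h = primitive hab a (pointwise D (delayLift hab τ ι κ h + delayLift hab τ ι' κ' v))) :
    pathIntegral hab (pointwise Λ (delayLift hab τ ι κ h + delayLift hab τ ι' κ' v)) =
      pairing hab (rieszPath (precomp ι' (hamiltonianForm Λ D p))) v +
        pairing hab (rieszPath (precomp κ' (hamiltonianForm Λ D p))) (shift hab (-τ) v) := by
  have hstate := hp.pathIntegral_hamiltonianForm_state hτ hτ'
    (pointwise D (delayLift hab τ ι κ h + delayLift hab τ ι' κ' v))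
  have htotal := pathIntegral_pointwise_hamiltonianForm hab Λ D p
    (delayLift hab τ ι κ h + delayLift hab τ ι' κ' v)
  rw [← hh] at hstate
  rw [map_add, map_add, hstate, pathIntegral_pointwise_delayLift] at htotal
  linarith

end IsCostate

theorem exists_sub_primitive_pointwise_delayLift_eq (hab : a ≤ b) (hτ : 0 ≤ τ) (ι κ : X →L[ℝ] Z)
    (D : C(Icc a b, Z →L[ℝ] X)) (r : C(Icc a b, X)) :
    ∃ h, h - primitive hab a (pointwise D (delayLift hab τ ι κ h)) = r := by
  simpa only [pointwise_delayLift] using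
    exists_solution_retarded hab hτ (precomp ι D) (precomp κ D) r

theorem exists_isCostate_stationary [CompleteSpace Y] (hab : a ≤ b) (hτ : 0 < τ) (hτ' : τ < b - a)
    (ι κ : X →L[ℝ] Z) (ι' κ' : Y →L[ℝ] Z) (Λ : C(Icc a b, Z →L[ℝ] ℝ)) (D : C(Icc a b, Z →L[ℝ] X))
    (hΛ : ∀ (h : C(Icc a b, X)) (v : C(Icc a b, Y)), v ⟨a, left_mem_Icc.2 hab⟩ = 0 →
      h = primitive hab a (pointwise D (delayLift hab τ ι κ h + delayLift hab τ ι' κ' v)) →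
      pathIntegral hab (pointwise Λ (delayLift hab τ ι κ h + delayLift hab τ ι' κ' v)) = 0) :
    ∃ p, IsCostate hab τ ι κ Λ D p ∧
      (∀ s ∈ Icc a (b - τ), IccExtend hab (rieszPath (precomp ι' (hamiltonianForm Λ D p))) s +
        IccExtend hab (rieszPath (precomp κ' (hamiltonianForm Λ D p))) (s + τ) = 0) ∧
      ∀ s ∈ Icc (b - τ) b,
        IccExtend hab (rieszPath (precomp ι' (hamiltonianForm Λ D p))) s = 0 := by
  obtain ⟨p, hp⟩ := exists_isCostate hab hτ.le ι κ Λ D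
  refine ⟨p, hp, eq_zero_of_forall_pairing_add_pairing_shift_eq_zero hab hτ hτ' fun v hv => ?_⟩
  obtain ⟨h, hh⟩ := exists_sub_primitive_pointwise_delayLift_eq hab hτ.le ι κ D
    (primitive hab a (pointwise D (delayLift hab τ ι' κ' v)))
  have hsol : h = primitive hab a
      (pointwise D (delayLift hab τ ι κ h + delayLift hab τ ι' κ' v)) := by
    rw [map_add, map_add]
    exact sub_eq_iff_eq_add'.1 hh
  rw [← hp.pathIntegral_eq_control_variation hτ.le hτ'.le ι' κ' hsol, hΛ h v hv hsol]

end LinearMaximumPrinciple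

section CostateRegularity

variable {V : Type*} [NormedAddCommGroup V] [NormedSpace ℝ V] {a b τ : ℝ}

theorem contDiffOn_one_of_hasDerivWithinAt (hab : a < b) {f f' : ℝ → V}
    (hf : ∀ t ∈ Icc a b, HasDerivWithinAt f (f' t) (Icc a b) t)
    (hf' : ContinuousOn f' (Icc a b)) : ContDiffOn ℝ 1 f (Icc a b) :=
  (contDiffOn_one_iff_derivWithin (uniqueDiffOn_Icc hab)).2
    ⟨fun t ht => (hf t ht).differentiableWithinAt,
      hf'.congr fun t ht => (hf t ht).derivWithin (uniqueDiffOn_Icc hab t ht)⟩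

theorem IccExtend_primitive_of_left_eq_zero (hab : a ≤ b) {w : C(Icc a b, V)}
    (hw : w ⟨a, left_mem_Icc.2 hab⟩ = 0) {t : ℝ} (ht : t ≤ b) :
    IccExtend hab (primitive hab a w) t = ∫ s in a..t, IccExtend hab w s := by
  rcases le_total a t with hat | hta
  · exact IccExtend_primitive hab a w ⟨hat, ht⟩
  · rw [IccExtend_of_le_left hab _ hta, primitive_left, intervalIntegral.integral_symm,
      integral_eq_zero_of_Icc hta fun s hs => (IccExtend_of_le_left hab _ hs.2).trans hw, neg_zero]

theorem IccExtend_tailIntegral_of_right_eq_zero (hab : a ≤ b) {w : C(Icc a b, V)}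
    (hw : w ⟨b, right_mem_Icc.2 hab⟩ = 0) {t : ℝ} (ht : a ≤ t) :
    IccExtend hab (tailIntegral hab w) t = ∫ s in t..b, IccExtend hab w s := by
  rcases le_total t b with htb | hbt
  · exact IccExtend_tailIntegral hab w ⟨ht, htb⟩
  · rw [IccExtend_of_right_le hab _ hbt, tailIntegral_right, intervalIntegral.integral_symm,
      integral_eq_zero_of_Icc hbt fun s hs => (IccExtend_of_right_le hab _ hs.1).trans hw, neg_zero]

theorem IccExtend_tailIntegral_add_shift (hab : a ≤ b) (α β : C(Icc a b, V)) {t : ℝ}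
    (ht : t ∈ Icc a b) :
    IccExtend hab (tailIntegral hab α + shift hab τ (tailIntegral hab β)) t =
      (∫ s in t..b, IccExtend hab α s) + IccExtend hab (tailIntegral hab β) (t + τ) := by
  rw [IccExtend_of_mem hab _ ht, ContinuousMap.add_apply, tailIntegral_apply, shift_apply]

theorem tailIntegral_add_shift_right (hab : a ≤ b) (hτ : 0 ≤ τ) (α β : C(Icc a b, V)) :
    IccExtend hab (tailIntegral hab α + shift hab τ (tailIntegral hab β)) b = 0 := by
  rw [IccExtend_tailIntegral_add_shift hab α β (right_mem_Icc.2 hab),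
    intervalIntegral.integral_same, IccExtend_of_right_le hab _ (le_add_of_nonneg_right hτ),
    tailIntegral_right, add_zero]

variable [CompleteSpace V]

theorem hasDerivWithinAt_IccExtend_primitive (hab : a ≤ b) {w : C(Icc a b, V)}
    (hw : w ⟨a, left_mem_Icc.2 hab⟩ = 0) {t : ℝ} (ht : t ≤ b) :
    HasDerivWithinAt (IccExtend hab (primitive hab a w)) (IccExtend hab w t) (Iic b) t :=
  (w.continuous.Icc_extend'.integral_hasStrictDerivAt a t).hasDerivAt.hasDerivWithinAt.congr_of_mem
    (fun _ hs => IccExtend_primitive_of_left_eq_zero hab hw hs) ht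

theorem hasDerivAt_integral_add_integral_add_const (hab : a ≤ b) (α β : C(Icc a b, V)) (t : ℝ) :
    HasDerivAt (fun t => (∫ s in t..b, IccExtend hab α s) + ∫ s in (t + τ)..b, IccExtend hab β s)
      (-IccExtend hab α t - IccExtend hab β (t + τ)) t :=
  ((hasDerivAt_integral_of_lower_limit α.continuous.Icc_extend' b t).fun_add
    ((hasDerivAt_integral_of_lower_limit β.continuous.Icc_extend' b (t + τ)).comp_add_const
      t τ)).congr_deriv (sub_eq_add_neg _ _).symm

theorem hasDerivWithinAt_tailIntegral_add_shift_left (hab : a ≤ b) (hτ : 0 ≤ τ)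
    (α β : C(Icc a b, V)) {t : ℝ} (ht : t ∈ Icc a (b - τ)) :
    HasDerivWithinAt (IccExtend hab (tailIntegral hab α + shift hab τ (tailIntegral hab β)))
      (-IccExtend hab α t - IccExtend hab β (t + τ)) (Icc a (b - τ)) t := by
  refine (hasDerivAt_integral_add_integral_add_const hab α β t).hasDerivWithinAt.congr_of_mem
    (fun s hs => ?_) ht
  rw [IccExtend_tailIntegral_add_shift hab α β ⟨hs.1, by linarith [hs.2]⟩,
    IccExtend_tailIntegral hab β ⟨by linarith [hs.1], by linarith [hs.2]⟩]

theorem hasDerivWithinAt_tailIntegral_add_shift_right (hab : a ≤ b) (hτ : τ ≤ b - a)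
    (α β : C(Icc a b, V)) {t : ℝ} (ht : t ∈ Icc (b - τ) b) :
    HasDerivWithinAt (IccExtend hab (tailIntegral hab α + shift hab τ (tailIntegral hab β)))
      (-IccExtend hab α t) (Icc (b - τ) b) t := by
  refine (hasDerivAt_integral_of_lower_limit α.continuous.Icc_extend' b
    t).hasDerivWithinAt.congr_of_mem (fun s hs => ?_) ht
  rw [IccExtend_tailIntegral_add_shift hab α β ⟨by linarith [hs.1], hs.2⟩,
    IccExtend_of_right_le hab _ (by linarith [hs.1]), tailIntegral_right, add_zero]

theorem contDiffOn_tailIntegral_add_shift (hab : a < b) (hτ : 0 ≤ τ) (α : C(Icc a b, V))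
    {β : C(Icc a b, V)} (hβ : β ⟨b, right_mem_Icc.2 hab.le⟩ = 0) :
    ContDiffOn ℝ 1 (IccExtend hab.le (tailIntegral hab.le α +
      shift hab.le τ (tailIntegral hab.le β))) (Icc a b) := by
  have : Continuous (IccExtend hab.le α) := α.continuous.Icc_extend'
  have : Continuous (IccExtend hab.le β) := β.continuous.Icc_extend'
  refine contDiffOn_one_of_hasDerivWithinAt hab (fun t ht =>
    (hasDerivAt_integral_add_integral_add_const (τ := τ) hab.le α β t).hasDerivWithinAt.congr_of_mem
      (fun s hs => ?_) ht) (by fun_prop)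
  rw [IccExtend_tailIntegral_add_shift hab.le α β hs,
    IccExtend_tailIntegral_of_right_eq_zero hab.le hβ (by linarith [hs.1])]

namespace IsCostate

variable {X Z : Type*} [NormedAddCommGroup X] [InnerProductSpace ℝ X] [CompleteSpace X]
  [NormedAddCommGroup Z] [NormedSpace ℝ Z] {ι κ : X →L[ℝ] Z} {p : C(Icc a b, X)}
  {Λ : C(Icc a b, Z →L[ℝ] ℝ)} {D : C(Icc a b, Z →L[ℝ] X)}

theorem IccExtend_right {hab : a ≤ b} (hp : IsCostate hab τ ι κ Λ D p) (hτ : 0 ≤ τ) :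
    IccExtend hab p b = 0 := by
  have h := tailIntegral_add_shift_right hab hτ (rieszPath (precomp ι (hamiltonianForm Λ D p)))
    (rieszPath (precomp κ (hamiltonianForm Λ D p)))
  rwa [← hp] at h

theorem hasDerivWithinAt_left {hab : a ≤ b} (hp : IsCostate hab τ ι κ Λ D p) (hτ : 0 ≤ τ) {t : ℝ}
    (ht : t ∈ Icc a (b - τ)) :
    HasDerivWithinAt (IccExtend hab p)
      (-IccExtend hab (rieszPath (precomp ι (hamiltonianForm Λ D p))) t -
        IccExtend hab (rieszPath (precomp κ (hamiltonianForm Λ D p))) (t + τ))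
      (Icc a (b - τ)) t := by
  have h := hasDerivWithinAt_tailIntegral_add_shift_left hab hτ
    (rieszPath (precomp ι (hamiltonianForm Λ D p)))
    (rieszPath (precomp κ (hamiltonianForm Λ D p))) ht
  rwa [← hp] at h

theorem hasDerivWithinAt_right {hab : a ≤ b} (hp : IsCostate hab τ ι κ Λ D p) (hτ : τ ≤ b - a)
    {t : ℝ} (ht : t ∈ Icc (b - τ) b) :
    HasDerivWithinAt (IccExtend hab p)
      (-IccExtend hab (rieszPath (precomp ι (hamiltonianForm Λ D p))) t) (Icc (b - τ) b) t := by
  have h := hasDerivWithinAt_tailIntegral_add_shift_right hab hτ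
    (rieszPath (precomp ι (hamiltonianForm Λ D p)))
    (rieszPath (precomp κ (hamiltonianForm Λ D p))) ht
  rwa [← hp] at h

theorem contDiffOn_left {hab : a ≤ b} (hp : IsCostate hab τ ι κ Λ D p) (hτ : 0 ≤ τ)
    (hτ' : τ < b - a) : ContDiffOn ℝ 1 (IccExtend hab p) (Icc a (b - τ)) :=
  contDiffOn_one_of_hasDerivWithinAt (by linarith) (fun _ => hp.hasDerivWithinAt_left hτ)
    ((ContinuousMap.continuous _).Icc_extend'.neg.sub
      ((ContinuousMap.continuous _).Icc_extend'.comp (continuous_add_const τ))).continuousOn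

theorem contDiffOn_right {hab : a ≤ b} (hp : IsCostate hab τ ι κ Λ D p) (hτ : 0 < τ)
    (hτ' : τ ≤ b - a) : ContDiffOn ℝ 1 (IccExtend hab p) (Icc (b - τ) b) :=
  contDiffOn_one_of_hasDerivWithinAt (by linarith) (fun _ => hp.hasDerivWithinAt_right hτ')
    (ContinuousMap.continuous _).Icc_extend'.neg.continuousOn

theorem contDiffOn (hab : a < b) (hp : IsCostate hab.le τ ι κ Λ D p) (hτ : 0 ≤ τ)
    (hb : rieszPath (precomp κ (hamiltonianForm Λ D p)) ⟨b, right_mem_Icc.2 hab.le⟩ = 0) :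
    ContDiffOn ℝ 1 (IccExtend hab.le p) (Icc a b) := by
  have h := contDiffOn_tailIntegral_add_shift hab hτ
    (rieszPath (precomp ι (hamiltonianForm Λ D p))) hb
  rwa [← hp] at h

end IsCostate

end CostateRegularity

section IntegralMultipliers

variable {a b τ : ℝ}

theorem pathIntegral_compLeftContinuous {V W : Type*} [NormedAddCommGroup V] [NormedSpace ℝ V]
    [CompleteSpace V] [NormedAddCommGroup W] [NormedSpace ℝ W] [CompleteSpace W] (hab : a ≤ b)
    (A : V →L[ℝ] W) (w : C(Icc a b, V)) :
    pathIntegral hab (A.compLeftContinuous ℝ _ w) = A (pathIntegral hab w) :=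
  A.intervalIntegral_comp_comm (w.continuous.Icc_extend'.intervalIntegrable a b)

variable {𝒳 X Z W H : Type*} [NormedAddCommGroup 𝒳] [NormedSpace ℝ 𝒳] [NormedAddCommGroup X]
  [InnerProductSpace ℝ X] [CompleteSpace X] [NormedAddCommGroup Z] [NormedSpace ℝ Z]
  [NormedAddCommGroup W] [NormedSpace ℝ W] [NormedAddCommGroup H] [InnerProductSpace ℝ H]
  {f : ℝ × Z → ℝ} {g : ℝ × Z → H} {φ : ℝ × Z → X}

theorem pathIntegral_fderivAlong_const_mul_sub_inner [CompleteSpace H] (hab : a < b)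
    (hf : ContDiffOn ℝ 1 f (Icc a b ×ˢ univ)) (hg : ContDiffOn ℝ 1 g (Icc a b ×ˢ univ)) {c : ℝ}
    {lam : H}
    (hfg : ContDiffOn ℝ 1 (fun x => c * f x - inner ℝ lam (g x)) (Icc a b ×ˢ univ))
    (z x : C(Icc a b, Z)) :
    pathIntegral hab.le (pointwise (fderivAlong hab hfg z) x) =
      c * pathIntegral hab.le (pointwise (fderivAlong hab hf z) x) -
        inner ℝ lam (pathIntegral hab.le (pointwise (fderivAlong hab hg z) x)) := by
  have hderiv : ∀ t, fderivAlong hab hfg z t =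
      c • fderivAlong hab hf z t - innerSL ℝ lam ∘L fderivAlong hab hg z t := fun t =>
    (hasFDerivAt_fderivAlong hab hfg z t).unique <|
      ((hasFDerivAt_fderivAlong hab hf z t).const_mul c).sub
        ((innerSL ℝ lam).hasFDerivAt.comp (z t) (hasFDerivAt_fderivAlong hab hg z t))
  have hpath : pointwise (fderivAlong hab hfg z) x = c • pointwise (fderivAlong hab hf z) x -
      (innerSL ℝ lam).compLeftContinuous ℝ _ (pointwise (fderivAlong hab hg z) x) := by
    ext t
    exact congrArg (· (x t)) (hderiv t)
  rw [hpath, map_sub, map_smul, pathIntegral_compLeftContinuous]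
  rfl

theorem hasStrictFDerivAt_nemytskii_add {f : ℝ × Z → W} (hab : a < b)
    (hf : ContDiffOn ℝ 1 f (Icc a b ×ˢ univ)) (z : C(Icc a b, Z)) (S : 𝒳 →L[ℝ] C(Icc a b, Z)) :
    HasStrictFDerivAt (fun x => nemytskii f hf.continuousOn (z + S x))
      (pointwise (fderivAlong hab hf z) ∘L S) 0 := by
  have h := hasStrictFDerivAt_nemytskii hab hf (z + S 0)
  have hcomp := h.comp 0 (S.hasStrictFDerivAt.const_add z)
  rwa [map_zero, add_zero] at hcomp

theorem exists_multipliers_of_isLocalExtrOn_pathIntegral [CompleteSpace 𝒳]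
    [FiniteDimensional ℝ H] (hab : a < b) (hτ : 0 ≤ τ)
    (hf : ContDiffOn ℝ 1 f (Icc a b ×ˢ univ)) (hg : ContDiffOn ℝ 1 g (Icc a b ×ˢ univ))
    (hφ : ContDiffOn ℝ 1 φ (Icc a b ×ˢ univ)) (z : C(Icc a b, Z)) (ι κ : X →L[ℝ] Z)
    {S : C(Icc a b, X) × 𝒳 →L[ℝ] C(Icc a b, Z)} (hS : ∀ h, S (h, 0) = delayLift hab.le τ ι κ h)
    (hextr : IsLocalExtrOn (fun x => pathIntegral hab.le (nemytskii f hf.continuousOn (z + S x)))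
      {x | x.1 = primitive hab.le a
          (nemytskii φ hφ.continuousOn (z + S x) - nemytskii φ hφ.continuousOn z) ∧
        pathIntegral hab.le (nemytskii g hg.continuousOn (z + S x)) =
          pathIntegral hab.le (nemytskii g hg.continuousOn z)} 0) :
    ∃ (c : ℝ) (mu : H), (c = 1 ∨ c = 0 ∧ mu ≠ 0) ∧
      ∀ x, x.1 = primitive hab.le a (pointwise (fderivAlong hab hφ z) (S x)) →
        c * pathIntegral hab.le (pointwise (fderivAlong hab hf z) (S x)) =
          inner ℝ mu (pathIntegral hab.le (pointwise (fderivAlong hab hg z) (S x))) := by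
  have hJ := (pathIntegral hab.le).hasStrictFDerivAt.comp 0
    (hasStrictFDerivAt_nemytskii_add hab hf z S)
  have hG := (pathIntegral hab.le).hasStrictFDerivAt.comp 0
    (hasStrictFDerivAt_nemytskii_add hab hg z S)
  have hF := (ContinuousLinearMap.fst ℝ C(Icc a b, X) 𝒳).hasStrictFDerivAt.sub
    ((primitive hab.le a).hasStrictFDerivAt.comp 0
      ((hasStrictFDerivAt_nemytskii_add hab hφ z S).sub_const (nemytskii φ hφ.continuousOn z)))
  have hsurj : Function.Surjective (ContinuousLinearMap.fst ℝ C(Icc a b, X) 𝒳 -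
      primitive hab.le a ∘L pointwise (fderivAlong hab hφ z) ∘L S) := fun r => by
    obtain ⟨h, rfl⟩ := exists_sub_primitive_pointwise_delayLift_eq hab.le hτ ι κ
      (fderivAlong hab hφ z) r
    exact ⟨(h, 0), by rw [← hS]; rfl⟩
  obtain ⟨c, mu, hc, hmul⟩ := exists_normalized_multipliers_of_surjective
    (by simpa [sub_eq_zero] using hextr) hJ hF hG hsurj
  exact ⟨c, mu, hc, fun x hx => hmul x (sub_eq_zero.2 hx)⟩

end IntegralMultipliers

section DelayedVariables

variable (X Y : Type*) [NormedAddCommGroup X] [NormedSpace ℝ X] [NormedAddCommGroup Y]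
  [NormedSpace ℝ Y]

/-- The inclusion of the directions `(q, 0, 0, 0)` of the current state. -/
def inState : X →L[ℝ] X × Y × X × Y := .inl ℝ X (Y × X × Y)

/-- The inclusion of the directions `(0, u, 0, 0)` of the current control. -/
def inControl : Y →L[ℝ] X × Y × X × Y := .inr ℝ X (Y × X × Y) ∘L .inl ℝ Y (X × Y)

/-- The inclusion of the directions `(0, 0, q, 0)` of the delayed state. -/
def inDelayedState : X →L[ℝ] X × Y × X × Y :=
  .inr ℝ X (Y × X × Y) ∘L .inr ℝ Y (X × Y) ∘L .inl ℝ X Y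

/-- The inclusion of the directions `(0, 0, 0, u)` of the delayed control. -/
def inDelayedControl : Y →L[ℝ] X × Y × X × Y :=
  .inr ℝ X (Y × X × Y) ∘L .inr ℝ Y (X × Y) ∘L .inr ℝ X Y

variable {X Y} {a b τ : ℝ}

/-- The variation of the path `(q t, u t, q (t - τ), u (t - τ))` when `q` and `u` are varied by
paths over `[a, b]`, which are continued to the left of `a` by their values at `a`. -/
def variation (hab : a ≤ b) (τ : ℝ) :
    C(Icc a b, X) × C(Icc a b, Y) →L[ℝ] C(Icc a b, X × Y × X × Y) :=
  (delayLift hab τ (inState X Y) (inDelayedState X Y)).coprod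
    (delayLift hab τ (inControl X Y) (inDelayedControl X Y))

theorem variation_apply (hab : a ≤ b) (τ : ℝ) (x : C(Icc a b, X) × C(Icc a b, Y)) (t : Icc a b) :
    variation hab τ x t =
      (x.1 t, x.2 t, IccExtend hab x.1 (t - τ), IccExtend hab x.2 (t - τ)) := by
  simp [variation, delayLift_apply, inState, inControl, inDelayedState, inDelayedControl]

theorem variation_left_eq_zero (hab : a ≤ b) (hτ : 0 ≤ τ) {x : C(Icc a b, X) × C(Icc a b, Y)}
    (hx₁ : x.1 ⟨a, left_mem_Icc.2 hab⟩ = 0) (hx₂ : x.2 ⟨a, left_mem_Icc.2 hab⟩ = 0) :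
    variation hab τ x ⟨a, left_mem_Icc.2 hab⟩ = 0 := by
  have hle : a - τ ≤ a := sub_le_self a hτ
  simp [variation_apply, IccExtend_of_le_left hab _ hle, hx₁, hx₂]

end DelayedVariables

section PartialGradients

variable {n m k : ℕ} {H : Pt n m → E n → E k → ℝ} {x : Pt n m} {r : E n} {lam : E k}
  {A : E n × E m × E n × E m →L[ℝ] ℝ}

theorem d₂_eq_toDual_symm (hA : HasFDerivAt (fun y => H (x.1, y) r lam) A x.2) :
    d₂ H x r lam = (InnerProductSpace.toDual ℝ (E n)).symm (A ∘L inState (E n) (E m)) :=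
  congrArg _ <| HasFDerivAt.fderiv <|
    hA.comp (f := fun y => (y, x.2.2)) x.2.1 (hasFDerivAt_prodMk_left _ _)

theorem d₃_eq_toDual_symm (hA : HasFDerivAt (fun y => H (x.1, y) r lam) A x.2) :
    d₃ H x r lam = (InnerProductSpace.toDual ℝ (E m)).symm (A ∘L inControl (E n) (E m)) :=
  congrArg _ <| HasFDerivAt.fderiv <|
    hA.comp (f := fun y => (x.2.1, y, x.2.2.2)) x.2.2.1 <|
      (hasFDerivAt_prodMk_right x.2.1 x.2.2).comp _ (hasFDerivAt_prodMk_left _ _)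

theorem d₄_eq_toDual_symm (hA : HasFDerivAt (fun y => H (x.1, y) r lam) A x.2) :
    d₄ H x r lam = (InnerProductSpace.toDual ℝ (E n)).symm (A ∘L inDelayedState (E n) (E m)) :=
  congrArg _ <| HasFDerivAt.fderiv <|
    hA.comp (f := fun y => (x.2.1, x.2.2.1, y, x.2.2.2.2)) x.2.2.2.1 <|
      (hasFDerivAt_prodMk_right x.2.1 x.2.2).comp _ <|
        (hasFDerivAt_prodMk_right x.2.2.1 x.2.2.2).comp _ (hasFDerivAt_prodMk_left _ _)

theorem d₅_eq_toDual_symm (hA : HasFDerivAt (fun y => H (x.1, y) r lam) A x.2) :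
    d₅ H x r lam = (InnerProductSpace.toDual ℝ (E m)).symm (A ∘L inDelayedControl (E n) (E m)) :=
  congrArg _ <| HasFDerivAt.fderiv <|
    hA.comp (f := fun y => (x.2.1, x.2.2.1, x.2.2.2.1, y)) x.2.2.2.2 <|
      (hasFDerivAt_prodMk_right x.2.1 x.2.2).comp _ <|
        (hasFDerivAt_prodMk_right x.2.2.1 x.2.2.2).comp _ (hasFDerivAt_prodMk_right _ _)

end PartialGradients

section DelayPath

variable {n m : ℕ} {a b τ : ℝ} {q : ℝ → E n} {u : ℝ → E m}

theorem exists_delayPt_eq (hτ : 0 ≤ τ) (hq : ContinuousOn q (Icc (a - τ) b))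
    (hu : ContinuousOn u (Icc (a - τ) b)) :
    ∃ z : C(Icc a b, E n × E m × E n × E m), ∀ t : Icc a b, delayPt τ q u t = (↑t, z t) := by
  have hmem : ∀ t : Icc a b, (t : ℝ) ∈ Icc (a - τ) b := fun t => ⟨by linarith [t.2.1], t.2.2⟩
  have hmem' : ∀ t : Icc a b, (t : ℝ) - τ ∈ Icc (a - τ) b := fun t =>
    ⟨by linarith [t.2.1], by linarith [t.2.2]⟩
  exact ⟨⟨fun t => (q t, u t, q (t - τ), u (t - τ)),
    (hq.comp_continuous (by fun_prop) hmem).prodMk <|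
      (hu.comp_continuous (by fun_prop) hmem).prodMk <|
        (hq.comp_continuous (by fun_prop) hmem').prodMk
          (hu.comp_continuous (by fun_prop) hmem')⟩, fun _ => rfl⟩

variable {z : C(Icc a b, E n × E m × E n × E m)}

theorem delayPt_add_variation (hab : a ≤ b) (hz : ∀ t : Icc a b, delayPt τ q u t = (↑t, z t))
    (x : C(Icc a b, E n) × C(Icc a b, E m)) (t : Icc a b) :
    delayPt τ (q + IccExtend hab x.1) (u + IccExtend hab x.2) t =
      (↑t, (z + variation hab τ x) t) := by
  have hzt : z t = (q t, u t, q (t - τ), u (t - τ)) := (congrArg Prod.snd (hz t)).symm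
  simp [delayPt, hzt, variation_apply]

theorem integral_comp_delayPt {W : Type*} [NormedAddCommGroup W] [NormedSpace ℝ W]
    {f : Pt n m → W} (hab : a ≤ b) (hf : ContinuousOn f (Icc a b ×ˢ univ))
    (hz : ∀ t : Icc a b, delayPt τ q u t = (↑t, z t)) :
    ∫ t in a..b, f (delayPt τ q u t) = pathIntegral hab (nemytskii f hf z) := by
  refine intervalIntegral.integral_congr fun t ht => ?_
  rw [uIcc_of_le hab] at ht
  simp only [IccExtend_of_mem hab _ ht, nemytskii_apply]
  exact congrArg f (hz ⟨t, ht⟩)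

end DelayPath

namespace Problem

variable {n m k : ℕ} {P : Problem n m k} {q : ℝ → E n} {u : ℝ → E m}
  {z : C(Icc P.t₁ P.t₂, E n × E m × E n × E m)}

theorem d₆_hamiltonian (x : Pt n m) (r : E n) (lam : E k) :
    d₆ P.hamiltonian x r lam = P.φ x := by
  refine HasGradientAt.gradient (hasGradientAt_iff_hasFDerivAt.2 ?_)
  refine (((hasFDerivAt_id r).inner ℝ (hasFDerivAt_const (P.φ x) r)).const_add
    (P.L x - inner ℝ lam (P.g x))).congr_fderiv ?_
  ext y
  simp [fderivInnerCLM_apply, real_inner_comm]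

theorem hasFDerivAt_hamiltonian (ht : P.t₁ < P.t₂) {lam : E k}
    (hℓ : ContDiffOn ℝ 1 (fun x => P.L x - inner ℝ lam (P.g x)) (Icc P.t₁ P.t₂ ×ˢ univ))
    (hφ : ContDiffOn ℝ 1 P.φ (Icc P.t₁ P.t₂ ×ˢ univ)) (p : C(Icc P.t₁ P.t₂, E n))
    (t : Icc P.t₁ P.t₂) :
    HasFDerivAt (fun y => P.hamiltonian (↑t, y) (p t) lam)
      (hamiltonianForm (fderivAlong ht hℓ z) (fderivAlong ht hφ z) p t) (z t) :=
  (hasFDerivAt_fderivAlong ht hℓ z t).add <|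
    (innerSL ℝ (p t)).hasFDerivAt.comp (z t) (hasFDerivAt_fderivAlong ht hφ z t)

theorem hasFDerivAt_hamiltonian_delayPt (ht : P.t₁ < P.t₂) {lam : E k}
    (hℓ : ContDiffOn ℝ 1 (fun x => P.L x - inner ℝ lam (P.g x)) (Icc P.t₁ P.t₂ ×ˢ univ))
    (hφ : ContDiffOn ℝ 1 P.φ (Icc P.t₁ P.t₂ ×ˢ univ))
    (hz : ∀ t : Icc P.t₁ P.t₂, delayPt P.τ q u t = (↑t, z t)) (p : C(Icc P.t₁ P.t₂, E n))
    {t : ℝ} (htI : t ∈ Icc P.t₁ P.t₂) :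
    HasFDerivAt
      (fun y => P.hamiltonian ((delayPt P.τ q u t).1, y) (IccExtend ht.le p t) lam)
      (IccExtend ht.le (hamiltonianForm (fderivAlong ht hℓ z) (fderivAlong ht hφ z) p) t)
      (delayPt P.τ q u t).2 := by
  rw [IccExtend_of_mem ht.le _ htI, IccExtend_of_mem ht.le _ htI, hz ⟨t, htI⟩]
  exact hasFDerivAt_hamiltonian ht hℓ hφ p ⟨t, htI⟩

theorem exists_isPontryaginExtremal (ht : P.t₁ < P.t₂) (hτ : 0 < P.τ) (hτ' : P.τ < P.t₂ - P.t₁)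
    {lam : E k}
    (hℓ : ContDiffOn ℝ 1 (fun x => P.L x - inner ℝ lam (P.g x)) (Icc P.t₁ P.t₂ ×ˢ univ))
    (hφ : ContDiffOn ℝ 1 P.φ (Icc P.t₁ P.t₂ ×ˢ univ))
    (hdyn : ∀ t ∈ Icc P.t₁ P.t₂,
      HasDerivWithinAt q (P.φ (delayPt P.τ q u t)) (Icc (P.t₁ - P.τ) P.t₂) t)
    (hz : ∀ t : Icc P.t₁ P.t₂, delayPt P.τ q u t = (↑t, z t))
    (hstat : ∀ x : C(Icc P.t₁ P.t₂, E n) × C(Icc P.t₁ P.t₂, E m),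
      x.2 ⟨P.t₁, left_mem_Icc.2 ht.le⟩ = 0 →
      x.1 = primitive ht.le P.t₁ (pointwise (fderivAlong ht hφ z) (variation ht.le P.τ x)) →
      pathIntegral ht.le (pointwise (fderivAlong ht hℓ z) (variation ht.le P.τ x)) = 0) :
    ∃ p : ℝ → E n, p P.t₂ = 0 ∧ P.IsPontryaginExtremal q u p lam ∧
      (d₄ P.hamiltonian (delayPt P.τ q u P.t₂) (p P.t₂) lam = 0 →
        ContDiffOn ℝ 1 p (Icc P.t₁ P.t₂)) := by
  obtain ⟨p, hp, hleft, hright⟩ := exists_isCostate_stationary ht.le hτ hτ' (inState (E n) (E m))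
    (inDelayedState (E n) (E m)) (inControl (E n) (E m)) (inDelayedControl (E n) (E m))
    (fderivAlong ht hℓ z) (fderivAlong ht hφ z) fun h v => hstat (h, v)
  have hderiv := fun {t} htI => hasFDerivAt_hamiltonian_delayPt ht hℓ hφ hz p (t := t) htI
  have mem_left : ∀ t ∈ Icc P.t₁ (P.t₂ - P.τ), t ∈ Icc P.t₁ P.t₂ := fun t h =>
    ⟨h.1, by linarith [h.2]⟩
  have mem_shifted : ∀ t ∈ Icc P.t₁ (P.t₂ - P.τ), t + P.τ ∈ Icc P.t₁ P.t₂ := fun t h =>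
    ⟨by linarith [h.1], by linarith [h.2]⟩
  have mem_right : ∀ t ∈ Icc (P.t₂ - P.τ) P.t₂, t ∈ Icc P.t₁ P.t₂ := fun t h =>
    ⟨by linarith [h.1], h.2⟩
  refine ⟨IccExtend ht.le p, hp.IccExtend_right hτ.le,
    { covector_C1_left := hp.contDiffOn_left hτ.le hτ'
      covector_C1_right := hp.contDiffOn_right hτ hτ'.le
      state := fun t htI => (d₆_hamiltonian (P := P) _ _ _).symm ▸ hdyn t htI
      costate_left := fun t htI => ?_
      costate_right := fun t htI => ?_
      stationary_left := fun t htI => ?_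
      stationary_right := fun t htI => ?_ }, fun hb => hp.contDiffOn ht hτ.le ?_⟩
  · rw [d₂_eq_toDual_symm (hderiv (mem_left t htI)), d₄_eq_toDual_symm (hderiv (mem_shifted t htI))]
    exact hp.hasDerivWithinAt_left hτ.le htI
  · rw [d₂_eq_toDual_symm (hderiv (mem_right t htI))]
    exact hp.hasDerivWithinAt_right hτ'.le htI
  · rw [d₃_eq_toDual_symm (hderiv (mem_left t htI)), d₅_eq_toDual_symm (hderiv (mem_shifted t htI))]
    exact hleft t htI
  · rw [d₃_eq_toDual_symm (hderiv (mem_right t htI))]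
    exact hright t htI
  · rwa [d₄_eq_toDual_symm (hderiv (right_mem_Icc.2 ht.le)), IccExtend_right] at hb

end Problem

section StartAtZero

variable {Y : Type*} [NormedAddCommGroup Y] [NormedSpace ℝ Y] {a b : ℝ}

/-- The translation of a path over `[a, b]` that makes it start at `0`, as an operator. It turns an
arbitrary path into a variation that extends continuously to the left of `a` by `0`. -/
def startAtZero (hab : a ≤ b) : C(Icc a b, Y) →L[ℝ] C(Icc a b, Y) :=
  .id ℝ _ - ContinuousMap.compCLM ℝ Y (.const _ ⟨a, left_mem_Icc.2 hab⟩)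

theorem startAtZero_left (hab : a ≤ b) (v : C(Icc a b, Y)) :
    startAtZero hab v ⟨a, left_mem_Icc.2 hab⟩ = 0 :=
  sub_self (v _)

theorem startAtZero_of_left_eq_zero (hab : a ≤ b) {v : C(Icc a b, Y)}
    (hv : v ⟨a, left_mem_Icc.2 hab⟩ = 0) : startAtZero hab v = v := by
  ext t
  exact sub_eq_self.2 hv

end StartAtZero

section FirstVariation

variable {X Y H : Type*} [NormedAddCommGroup X] [InnerProductSpace ℝ X] [CompleteSpace X]
  [NormedAddCommGroup Y] [NormedSpace ℝ Y] [CompleteSpace Y] [NormedAddCommGroup H]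
  [InnerProductSpace ℝ H] [FiniteDimensional ℝ H] {a b τ : ℝ} {f : ℝ × X × Y × X × Y → ℝ}
  {g : ℝ × X × Y × X × Y → H} {φ : ℝ × X × Y × X × Y → X}

theorem exists_multipliers_of_isLocalExtrOn_variation (hab : a < b) (hτ : 0 ≤ τ)
    (hf : ContDiffOn ℝ 1 f (Icc a b ×ˢ univ)) (hg : ContDiffOn ℝ 1 g (Icc a b ×ˢ univ))
    (hφ : ContDiffOn ℝ 1 φ (Icc a b ×ˢ univ)) (z : C(Icc a b, X × Y × X × Y))
    (hextr : IsLocalExtrOn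
      (fun x => pathIntegral hab.le (nemytskii f hf.continuousOn (z + variation hab.le τ x)))
      {x | x.2 ⟨a, left_mem_Icc.2 hab.le⟩ = 0 ∧
        x.1 = primitive hab.le a (nemytskii φ hφ.continuousOn (z + variation hab.le τ x) -
          nemytskii φ hφ.continuousOn z) ∧
        pathIntegral hab.le (nemytskii g hg.continuousOn (z + variation hab.le τ x)) =
          pathIntegral hab.le (nemytskii g hg.continuousOn z)} 0) :
    ∃ (c : ℝ) (mu : H), (c = 1 ∨ c = 0 ∧ mu ≠ 0) ∧
      ∀ x : C(Icc a b, X) × C(Icc a b, Y), x.2 ⟨a, left_mem_Icc.2 hab.le⟩ = 0 →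
        x.1 = primitive hab.le a (pointwise (fderivAlong hab hφ z) (variation hab.le τ x)) →
        c * pathIntegral hab.le (pointwise (fderivAlong hab hf z) (variation hab.le τ x)) =
          inner ℝ mu
            (pathIntegral hab.le (pointwise (fderivAlong hab hg z) (variation hab.le τ x))) := by
  let R : C(Icc a b, X) × C(Icc a b, Y) →L[ℝ] C(Icc a b, X) × C(Icc a b, Y) :=
    (ContinuousLinearMap.id ℝ _).prodMap (startAtZero hab.le)
  have hlift : ∀ h, (variation hab.le τ ∘L R) (h, 0) =
      delayLift hab.le τ (inState X Y) (inDelayedState X Y) h := fun h => by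
    simp [variation, R]
  rw [← map_zero R] at hextr
  obtain ⟨c, mu, hc, hmul⟩ := exists_multipliers_of_isLocalExtrOn_pathIntegral hab hτ hf hg hφ z
    (inState X Y) (inDelayedState X Y) hlift <|
      hextr.comp_continuousOn R (fun x hx => ⟨startAtZero_left hab.le x.2, hx⟩)
        R.continuous.continuousOn (by simp)
  refine ⟨c, mu, hc, fun x hx₂ hx₁ => ?_⟩
  have hR : R x = x := Prod.ext rfl (startAtZero_of_left_eq_zero hab.le hx₂)
  simpa only [ContinuousLinearMap.comp_apply, hR, hx₁, forall_const] using hmul x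

end FirstVariation

namespace Problem

variable {n m k : ℕ} {P : Problem n m k} {q : ℝ → E n} {u : ℝ → E m}
  {z : C(Icc P.t₁ P.t₂, E n × E m × E n × E m)}

theorem isAdmissible_add_variation (ht : P.t₁ < P.t₂) (hτ : 0 ≤ P.τ)
    (hg : ContinuousOn P.g (Icc P.t₁ P.t₂ ×ˢ univ))
    (hφ : ContinuousOn P.φ (Icc P.t₁ P.t₂ ×ˢ univ)) (hadm : P.IsAdmissible q u)
    (hz : ∀ t : Icc P.t₁ P.t₂, delayPt P.τ q u t = (↑t, z t))
    {x : C(Icc P.t₁ P.t₂, E n) × C(Icc P.t₁ P.t₂, E m)}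
    (hx₂ : x.2 ⟨P.t₁, left_mem_Icc.2 ht.le⟩ = 0)
    (hstate : x.1 = primitive ht.le P.t₁
      (nemytskii P.φ hφ (z + variation ht.le P.τ x) - nemytskii P.φ hφ z))
    (hiso : pathIntegral ht.le (nemytskii P.g hg (z + variation ht.le P.τ x)) = P.l) :
    P.IsAdmissible (q + IccExtend ht.le x.1) (u + IccExtend ht.le x.2) := by
  set w := nemytskii P.φ hφ (z + variation ht.le P.τ x) - nemytskii P.φ hφ z with hw
  have hx₁ : x.1 ⟨P.t₁, left_mem_Icc.2 ht.le⟩ = 0 := hstate ▸ primitive_left ht.le w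
  have hw₀ : w ⟨P.t₁, left_mem_Icc.2 ht.le⟩ = 0 := by
    simp [hw, nemytskii_apply, variation_left_eq_zero ht.le hτ hx₁ hx₂]
  have hz' := delayPt_add_variation ht.le hz x
  have hderiv : ∀ t ∈ Icc (P.t₁ - P.τ) P.t₂, HasDerivWithinAt (IccExtend ht.le x.1)
      (IccExtend ht.le w t) (Icc (P.t₁ - P.τ) P.t₂) t := fun t htI => by
    rw [hstate]
    exact (hasDerivWithinAt_IccExtend_primitive ht.le hw₀ htI.2).mono Icc_subset_Iic_self
  exact {
    state_C1 := hadm.state_C1.add <| contDiffOn_one_of_hasDerivWithinAt (by linarith) hderiv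
      w.continuous.Icc_extend'.continuousOn
    control_C0 := hadm.control_C0.add x.2.continuous.Icc_extend'.continuousOn
    dynamics := fun t htI => by
      refine ((hadm.dynamics t htI).add
        (hderiv t ⟨by linarith [htI.1], htI.2⟩)).congr_deriv ?_
      rw [IccExtend_of_mem ht.le _ htI, hz ⟨t, htI⟩, hz' ⟨t, htI⟩]
      exact add_sub_cancel _ _
    isoperimetric := (integral_comp_delayPt ht.le hg hz').trans hiso
    initial := fun t htI => by
      simp [IccExtend_of_le_left ht.le _ htI.2, hx₁, hadm.initial t htI] }

theorem isLocalMinOn_pathIntegral (ht : P.t₁ < P.t₂) (hτ : 0 ≤ P.τ)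
    (hL : ContinuousOn P.L (Icc P.t₁ P.t₂ ×ˢ univ))
    (hg : ContinuousOn P.g (Icc P.t₁ P.t₂ ×ˢ univ))
    (hφ : ContinuousOn P.φ (Icc P.t₁ P.t₂ ×ˢ univ)) (hmin : P.IsLocalMinimizer q u)
    (hz : ∀ t : Icc P.t₁ P.t₂, delayPt P.τ q u t = (↑t, z t)) :
    IsLocalMinOn
      (fun x => pathIntegral ht.le (nemytskii P.L hL (z + variation ht.le P.τ x)))
      {x | x.2 ⟨P.t₁, left_mem_Icc.2 ht.le⟩ = 0 ∧
        x.1 = primitive ht.le P.t₁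
          (nemytskii P.φ hφ (z + variation ht.le P.τ x) - nemytskii P.φ hφ z) ∧
        pathIntegral ht.le (nemytskii P.g hg (z + variation ht.le P.τ x)) =
          pathIntegral ht.le (nemytskii P.g hg z)} 0 := by
  obtain ⟨hadm, ε, hε, hle⟩ := hmin
  filter_upwards [nhdsWithin_le_nhds (Metric.ball_mem_nhds 0 hε), self_mem_nhdsWithin]
    with x hxε ⟨hx₂, hstate, hiso⟩
  have hl : pathIntegral ht.le (nemytskii P.g hg z) = P.l :=
    (integral_comp_delayPt ht.le hg hz).symm.trans hadm.isoperimetric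
  have hadm' := isAdmissible_add_variation ht hτ hg hφ hadm hz hx₂ hstate (hiso.trans hl)
  have hcost := integral_comp_delayPt ht.le hL hz
  have hcost' := integral_comp_delayPt ht.le hL (delayPt_add_variation ht.le hz x)
  rw [map_zero, add_zero, ← hcost, ← hcost']
  refine hle _ _ hadm' fun t _ => ?_
  have hx : ‖x‖ < ε := mem_ball_zero_iff.1 hxε
  simp only [Pi.add_apply, add_sub_cancel_left]
  exact ⟨(x.1.norm_coe_le_norm _).trans_lt ((norm_fst_le x).trans_lt hx),
    (x.2.norm_coe_le_norm _).trans_lt ((norm_snd_le x).trans_lt hx)⟩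

end Problem

end DelayControl

end

theorem mainTheorem4_general {n m k : ℕ} (P : DelayControl.Problem n m k)
    (ht : P.t₁ < P.t₂) (hτ : 0 < P.τ) (hτ' : P.τ < P.t₂ - P.t₁)
    (hL : ContDiffOn ℝ 1 P.L (Set.Icc P.t₁ P.t₂ ×ˢ Set.univ))
    (hg : ContDiffOn ℝ 1 P.g (Set.Icc P.t₁ P.t₂ ×ˢ Set.univ))
    (hφ : ContDiffOn ℝ 1 P.φ (Set.Icc P.t₁ P.t₂ ×ˢ Set.univ))
    (q : ℝ → DelayControl.E n) (u : ℝ → DelayControl.E m) (hmin : P.IsLocalMinimizer q u) :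
    ∃ (c : ℝ) (lam : DelayControl.E k) (p : ℝ → DelayControl.E n),
      (c = 1 ∨ c = 0 ∧ lam ≠ 0) ∧ p P.t₂ = 0 ∧
      DelayControl.Problem.IsPontryaginExtremal { P with L := fun x => c * P.L x } q u p lam ∧
      (DelayControl.d₄ (DelayControl.Problem.hamiltonian { P with L := fun x => c * P.L x })
          (DelayControl.delayPt P.τ q u P.t₂) (p P.t₂) lam = 0 →
        ContDiffOn ℝ 1 p (Set.Icc P.t₁ P.t₂)) := by
  obtain ⟨z, hz⟩ := DelayControl.exists_delayPt_eq hτ.le hmin.1.state_C1.continuousOn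
    hmin.1.control_C0
  obtain ⟨c, lam, hc, hmul⟩ := DelayControl.exists_multipliers_of_isLocalExtrOn_variation ht hτ.le
    hL hg hφ z (.inl (DelayControl.Problem.isLocalMinOn_pathIntegral ht hτ.le hL.continuousOn
      hg.continuousOn hφ.continuousOn hmin hz))
  have hℓ : ContDiffOn ℝ 1 (fun x => c * P.L x - inner ℝ lam (P.g x))
      (Set.Icc P.t₁ P.t₂ ×ˢ Set.univ) :=
    (contDiffOn_const.mul hL).sub (contDiffOn_const.inner ℝ hg)
  obtain ⟨p, hp⟩ := DelayControl.Problem.exists_isPontryaginExtremal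
    (P := { P with L := fun x => c * P.L x }) ht hτ hτ' hℓ hφ hmin.1.dynamics hz
    fun x hx₂ hx₁ => by
      rw [DelayControl.pathIntegral_fderivAlong_const_mul_sub_inner ht hL hg hℓ, sub_eq_zero]
      exact hmul x hx₂ hx₁
  exact ⟨c, lam, p, hc, hp⟩

theorem mainTheorem4 {n m k : ℕ} (P : DelayControl.Problem n m k)
    (ht : P.t₁ < P.t₂) (hτ : 0 < P.τ) (hτ' : P.τ < P.t₂ - P.t₁)
    (hL : ContDiffOn ℝ 1 P.L (Set.Icc P.t₁ P.t₂ ×ˢ Set.univ))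
    (hg : ContDiffOn ℝ 1 P.g (Set.Icc P.t₁ P.t₂ ×ˢ Set.univ))
    (hφ : ContDiffOn ℝ 1 P.φ (Set.Icc P.t₁ P.t₂ ×ˢ Set.univ))
    (q : ℝ → DelayControl.E n) (u : ℝ → DelayControl.E m)
    (hmin : P.IsLocalMinimizer q u) (hnormal : P.IsNormal q u) :
    ∃ (lam : DelayControl.E k) (p : ℝ → DelayControl.E n),
      P.IsPontryaginExtremal q u p lam ∧
      (DelayControl.d₄ P.hamiltonian (DelayControl.delayPt P.τ q u P.t₂) (p P.t₂) lam = 0 →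
        ContDiffOn ℝ 1 p (Set.Icc P.t₁ P.t₂)) := by
  obtain ⟨c, lam, p, rfl | ⟨rfl, hlam⟩, hp, hext, hC1⟩ :=
    mainTheorem4_general P ht hτ hτ' hL hg hφ q u hmin
  · simp only [one_mul] at hext hC1
    exact ⟨lam, p, hext, hC1⟩
  · simp only [zero_mul] at hext
    exact absurd ⟨lam, p, hlam, hp, hext⟩ hnormal
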